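/- Let $d\ge 1$, let $\Omega\subset\mathbb R^d$ be a bounded domain (non-empty, open, connected) of class $\mathfrak N^{2,1}$, and let $1\le p<\infty$. Class $\mathfrak N^{2,1}$ means: there are $a,b>0$, finitely many Cartesian coordinate systems $x_r=(x_r',x_r^d)$, $r=1,\dots,m$, and functions $a_r\in C^{2,1}(\overline{\Delta_r})$ on the cube $\Delta_r=\{|x_r^j|<a,\ j=1,\dots,d-1\}$, such that each point of $\partial\Omega$ has, for some $r$, an open neighbourhood $V$ with $$V\cap\partial\Omega=\{(x_r',a_r(x_r')):x_r'\in\Delta_r\},\quad V\cap\Omega=\{(x_r',x_r^d):x_r'\in\Delta_r,\ a_r(x_r')<x_r^d<a_r(x_r')+b\},$$ $$V\cap(\mathbb R^d\setminus\overline\Omega)=\{(x_r',x_r^d):x_r'\in\Delta_r,\ a_r(x_r')-b<x_r^d<a_r(x_r')\},$$ and each $r$ occurs for some such $V$. Fix such a system. For complex functions on $\partial\Omega$ let $\|f\|_{p,\partial\Omega}=\big(\sum_{r=1}^m\int_{\Delta_r}|f(x_r',a_r(x_r'))|^p\,dx_r'\big)^{1/p}$, with $L^p(\partial\Omega)$ the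 corresponding space, and for complex functions on $\Omega$ let $\|u\|_{k,p,\Omega}=\big(\sum_{|\alpha|\le k}\int_\Omega|\partial^\alpha u|^p\,dx\big)^{1/p}$ be the norm of $W^{k,p}(\Omega)$, with weak derivatives. Let $\nu$ be the outer unit normal on $\partial\Omega$, given in the $r$-th coordinate system by $(1+|\nabla a_r|^2)^{-1/2}(\nabla a_r,-1)$. A trace map is a bounded linear map $\gamma_0:W^{1,p}(\Omega)\to L^p(\partial\Omega)$ with $\gamma_0u=u|_{\partial\Omega}$ whenever $u$ is the restriction of a $C^\infty$ function on $\mathbb R^d$. Such a map exists, and there is a constant $\widetilde c_p>0$, independent of $u$, such that for every trace map $\gamma_0$ and every $u\in W^{2,p}(\Omega)$ the normal derivative $\partial_\nu u=\sum_{j=1}^d\nu_j\,\gamma_0(\partial_ju)$ is in $L^p(\partial\Omega)$ and $$\|\partial_\nu u\|_{p,\partial\Omega}\le\widetilde c_p\,\|u\|_{1,p,\Omega}^{\frac{p-1}{p}}\,\|u\|_{2,p,\Omega}^{\frac1p}.$$ -/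

import Mathlib

open MeasureTheory Set Filter Topology
open scoped NNReal ENNReal ContDiff

noncomputable section

/-! ## Sobolev spaces on an open subset of Euclidean space -/

/-- Euclidean space of dimension `d`. -/
abbrev Euc (d : ℕ) : Type := EuclideanSpace ℝ (Fin d)

/-- The classical partial derivative `∂_j φ`. -/
def partialD {d : ℕ} (j : Fin d) (φ : Euc d → ℝ) : Euc d → ℝ :=
  fun x => fderiv ℝ φ x (EuclideanSpace.single j 1)

/-- The classical derivative `∂^α φ = ∂_0^{α_0} ⋯ ∂_{d-1}^{α_{d-1}} φ` for a multi-index `α`. -/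
def multiD {d : ℕ} (α : Fin d → ℕ) (φ : Euc d → ℝ) : Euc d → ℝ :=
  (List.finRange d).foldr (fun j g => (partialD j)^[α j] g) φ

/-- `v` is a weak (distributional) derivative `∂^α u` of the complex function `u` in `Ω`. -/
def HasWeakD {d : ℕ} (Ω : Set (Euc d)) (α : Fin d → ℕ) (u v : Euc d → ℂ) : Prop :=
  LocallyIntegrableOn u Ω ∧ LocallyIntegrableOn v Ω ∧
    ∀ φ : Euc d → ℝ, ContDiff ℝ ∞ φ → HasCompactSupport φ → tsupport φ ⊆ Ω →
      ∫ x in Ω, multiD α φ x • u x = (-1) ^ (∑ j, α j) * ∫ x in Ω, φ x • v x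

open Classical in
/-- A representative of the weak derivative `∂^α u` in `Ω`; it is unique up to a null subset of an
open set `Ω`. By convention it is `0` if `u` has no weak derivative `∂^α u`. -/
def weakD {d : ℕ} (Ω : Set (Euc d)) (α : Fin d → ℕ) (u : Euc d → ℂ) : Euc d → ℂ :=
  if h : ∃ v, HasWeakD Ω α u v then h.choose else 0

/-- `u ∈ W^{k,p}(Ω)`, for real `p`: `u` and all its weak derivatives of order at most `k` are in
`L^p(Ω)`. -/
def MemSobolev {d : ℕ} (k : ℕ) (p : ℝ) (Ω : Set (Euc d)) (u : Euc d → ℂ) : Prop :=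
  MemLp u (ENNReal.ofReal p) (volume.restrict Ω) ∧
    ∀ α : Fin d → ℕ, ∑ j, α j ≤ k →
      ∃ v, HasWeakD Ω α u v ∧ MemLp v (ENNReal.ofReal p) (volume.restrict Ω)

/-- The norm `‖u‖_{k,p,Ω} = (∑_{|α| ≤ k} ∫_Ω |∂^α u|^p dx)^{1/p}`. -/
def sobolevNorm {d : ℕ} (k : ℕ) (p : ℝ) (Ω : Set (Euc d)) (u : Euc d → ℂ) : ℝ :=
  (∑ l ∈ Finset.range (k + 1), ∑ α ∈ Finset.piAntidiag (Finset.univ : Finset (Fin d)) l,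
    ∫ x in Ω, ‖weakD Ω α u x‖ ^ p) ^ (1 / p)

/-! ## Domains whose boundary is locally a graph -/

/-- The open cube `Δ = {x' : |x'_j| < a for all j}` in dimension `n`. -/
def openCube (n : ℕ) (a : ℝ) : Set (Euc n) := {x | ∀ j, |x j| < a}

/-- The closed cube, the closure of `Δ` when `a > 0`. -/
def closedCube (n : ℕ) (a : ℝ) : Set (Euc n) := {x | ∀ j, |x j| ≤ a}

/-- The vector `(x', t)` of dimension `n + 1`. -/
def joinLast {n : ℕ} (x : Euc n) (t : ℝ) : Euc (n + 1) :=
  WithLp.toLp 2 (Fin.snoc (α := fun _ => ℝ) (fun j => x j) t)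

/-- In the neighbourhood `V`, and in the Cartesian coordinates given by `e` (which sends local
coordinates to points), `∂Ω` is the graph of `f` over the open cube, `Ω` is the part of height
less than `b` above the graph and the exterior is the part of depth less than `b` below it. -/
def IsGraphPatch {n : ℕ} (Ω : Set (Euc (n + 1))) (a b : ℝ)
    (e : Euc (n + 1) ≃ᵃⁱ[ℝ] Euc (n + 1)) (f : Euc n → ℝ) (V : Set (Euc (n + 1))) : Prop :=
  IsOpen V ∧
  V ∩ frontier Ω = {z | ∃ x ∈ openCube n a, z = e (joinLast x (f x))} ∧
  V ∩ Ω = {z | ∃ x ∈ openCube n a, ∃ t, f x < t ∧ t < f x + b ∧ z = e (joinLast x t)} ∧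
  V ∩ (closure Ω)ᶜ = {z | ∃ x ∈ openCube n a, ∃ t, f x - b < t ∧ t < f x ∧ z = e (joinLast x t)}

/-- A finite system of local Cartesian coordinates and functions describing `∂Ω` as a continuous
boundary. Every chart of the system describes some piece of `∂Ω`. -/
structure GraphSystem {n : ℕ} (Ω : Set (Euc (n + 1))) where
  /-- number of charts -/
  m : ℕ
  /-- half of the side length of the cubes -/
  a : ℝ
  /-- height of the strips -/
  b : ℝ
  a_pos : 0 < a
  b_pos : 0 < b
  /-- the local coordinate systems -/
  coord : Fin m → (Euc (n + 1) ≃ᵃⁱ[ℝ] Euc (n + 1))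
  /-- the functions whose graphs describe the boundary -/
  fn : Fin m → Euc n → ℝ
  fn_cont : ∀ r, ContinuousOn (fn r) (closedCube n a)
  cover : ∀ z ∈ frontier Ω, ∃ r V, z ∈ V ∧ IsGraphPatch Ω a b (coord r) (fn r) V
  patch : ∀ r, ∃ V, IsGraphPatch Ω a b (coord r) (fn r) V

namespace GraphSystem

variable {n : ℕ} {Ω : Set (Euc (n + 1))}

/-- The system exhibits `Ω` as a domain of class `𝔑^{k,μ}`: its functions are of class `C^{k,μ}`
on the closed cube. -/
def IsOfClass (A : GraphSystem Ω) (k : ℕ) (μ : ℝ≥0) : Prop :=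
  ∀ r, ContDiffOn ℝ k (A.fn r) (closedCube n A.a) ∧
    ∀ i ≤ k, ∃ c : ℝ≥0,
      HolderOnWith c μ (iteratedFDerivWithin ℝ i (A.fn r) (closedCube n A.a)) (closedCube n A.a)

/-- The boundary point `(x', a_r(x'))` of the `r`-th chart. -/
def bdryPt (A : GraphSystem Ω) (r : Fin A.m) (x : Euc n) : Euc (n + 1) :=
  A.coord r (joinLast x (A.fn r x))

/-- `f = g` almost everywhere on `∂Ω`. -/
def BdryAEEq (A : GraphSystem Ω) (f g : Euc (n + 1) → ℂ) : Prop :=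
  ∀ r, ∀ᵐ x ∂(volume.restrict (openCube n A.a)), f (A.bdryPt r x) = g (A.bdryPt r x)

/-- `f ∈ L^p(∂Ω)`. Only the values of `f` on `∂Ω` matter. -/
def MemLpBdry (A : GraphSystem Ω) (p : ℝ) (f : Euc (n + 1) → ℂ) : Prop :=
  ∀ r, MemLp (fun x => f (A.bdryPt r x)) (ENNReal.ofReal p) (volume.restrict (openCube n A.a))

/-- The norm `‖f‖_{p,∂Ω} = (∑_r ∫_{Δ_r} |f(x', a_r(x'))|^p dx')^{1/p}`. -/
def bdryNorm (A : GraphSystem Ω) (p : ℝ) (f : Euc (n + 1) → ℂ) : ℝ :=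
  (∑ r, ∫ x in openCube n A.a, ‖f (A.bdryPt r x)‖ ^ p) ^ (1 / p)

/-- `γ` is a trace map `W^{1,p}(Ω) → L^p(∂Ω)`: it is linear and bounded, and it is the
restriction to `∂Ω` on smooth functions. Elements of both spaces are given by representatives. -/
structure IsTraceMap (A : GraphSystem Ω) (p : ℝ)
    (γ : (Euc (n + 1) → ℂ) → (Euc (n + 1) → ℂ)) : Prop where
  mem : ∀ u, MemSobolev 1 p Ω u → A.MemLpBdry p (γ u)
  map_add : ∀ u v, MemSobolev 1 p Ω u → MemSobolev 1 p Ω v →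
    A.BdryAEEq (γ (u + v)) (γ u + γ v)
  map_smul : ∀ (c : ℂ) (u), MemSobolev 1 p Ω u → A.BdryAEEq (γ (c • u)) (c • γ u)
  bounded : ∃ C : ℝ, ∀ u, MemSobolev 1 p Ω u → A.bdryNorm p (γ u) ≤ C * sobolevNorm 1 p Ω u
  smooth : ∀ u : Euc (n + 1) → ℂ, ContDiff ℝ ∞ u → A.BdryAEEq (γ u) u

/-- The outer unit normal `(1 + |∇a_r|²)^{-1/2} (∇a_r, -1)` in the `r`-th chart. -/
def localNormal (A : GraphSystem Ω) (r : Fin A.m) (x : Euc n) : Euc (n + 1) :=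
  (A.coord r).linearIsometryEquiv
    ((√(1 + ‖gradient (A.fn r) x‖ ^ 2))⁻¹ • joinLast (gradient (A.fn r) x) (-1))

open Classical in
/-- The outer unit normal `ν` on `∂Ω`, computed in any chart around the point; `outerNormal_bdryPt`
below shows that all charts give the same vector. -/
def outerNormal (A : GraphSystem Ω) (z : Euc (n + 1)) : Euc (n + 1) :=
  if h : ∃ q : Fin A.m × Euc n, q.2 ∈ openCube n A.a ∧ z = A.bdryPt q.1 q.2 then
    A.localNormal h.choose.1 h.choose.2
  else 0

/-- The normal derivative `∂_ν u = ∑_j ν_j γ(∂_j u)` on `∂Ω`, for a trace map `γ`. -/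
def normalD (A : GraphSystem Ω) (γ : (Euc (n + 1) → ℂ) → (Euc (n + 1) → ℂ))
    (u : Euc (n + 1) → ℂ) : Euc (n + 1) → ℂ :=
  fun z => ∑ j, (A.outerNormal z j : ℂ) * γ (weakD Ω (Pi.single j 1) u) z

/-! ### The outer normal does not depend on the chart -/

theorem openCube_mem_nhds {a : ℝ} {x : Euc n} (hx : x ∈ openCube n a) : openCube n a ∈ 𝓝 x := by
  have : openCube n a = ⋂ j, {y : Euc n | |y j| < a} := by ext; simp [openCube]
  rw [this]
  exact (isOpen_iInter_of_finite fun j =>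
    isOpen_lt (by fun_prop) continuous_const).mem_nhds (by simpa [openCube] using hx)

theorem joinLast_add_smul (x y : Euc n) (s t c : ℝ) :
    joinLast (x + c • y) (s + c * t) = joinLast x s + c • joinLast y t := by
  ext j
  refine Fin.lastCases ?_ (fun i => ?_) j <;> simp [joinLast]

theorem inner_joinLast (x y : Euc n) (s t : ℝ) :
    inner ℝ (joinLast x s) (joinLast y t) = inner ℝ x y + s * t := by
  simp [joinLast, PiLp.inner_apply, Fin.sum_univ_castSucc, mul_comm]

theorem exists_joinLast (z : Euc (n + 1)) : ∃ (y : Euc n) (s : ℝ), z = joinLast y s := by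
  refine ⟨WithLp.toLp 2 fun j => z j.castSucc, z (Fin.last n), ?_⟩
  ext j
  refine Fin.lastCases ?_ (fun i => ?_) j <;> simp [joinLast]

theorem norm_localNormal (A : GraphSystem Ω) (r : Fin A.m) (x : Euc n) :
    ‖A.localNormal r x‖ = 1 := by
  set g := gradient (A.fn r) x with hg
  have h1 : ‖joinLast g (-1)‖ = √(1 + ‖g‖ ^ 2) := by
    rw [← Real.sqrt_sq (norm_nonneg (joinLast g (-1))), ← real_inner_self_eq_norm_sq,
      inner_joinLast, real_inner_self_eq_norm_sq]
    congr 1; ring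
  have h2 : 0 < √(1 + ‖g‖ ^ 2) := by positivity
  rw [localNormal, LinearIsometryEquiv.norm_map, norm_smul, ← hg, h1, norm_inv,
    Real.norm_of_nonneg h2.le, inv_mul_cancel₀ h2.ne']

theorem differentiableAt_fn {A : GraphSystem Ω} {k : ℕ} {μ : ℝ≥0} (hA : A.IsOfClass k μ)
    (hk : 1 ≤ k) (r : Fin A.m) {x : Euc n} (hx : x ∈ openCube n A.a) :
    DifferentiableAt ℝ (A.fn r) x := by
  have h : closedCube n A.a ∈ 𝓝 x :=
    mem_of_superset (openCube_mem_nhds hx) fun y hy j => (hy j).le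
  exact (((hA r).1).contDiffAt h).differentiableAt (by exact_mod_cast (by omega : k ≠ 0))

/-- Directions forming an obtuse (acute) angle with the local normal point into (out of) `Ω`. -/
theorem localNormal_side {A : GraphSystem Ω} {k : ℕ} {μ : ℝ≥0} (hA : A.IsOfClass k μ)
    (hk : 1 ≤ k) (r : Fin A.m) {x : Euc n} (hx : x ∈ openCube n A.a) (w : Euc (n + 1)) :
    (inner ℝ w (A.localNormal r x) < 0 → ∀ᶠ ε in 𝓝[>] (0 : ℝ), A.bdryPt r x + ε • w ∈ Ω) ∧
    (0 < inner ℝ w (A.localNormal r x) →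
      ∀ᶠ ε in 𝓝[>] (0 : ℝ), A.bdryPt r x + ε • w ∈ (closure Ω)ᶜ) := by
  obtain ⟨V, -, -, hV2, hV3⟩ := A.patch r
  set f := A.fn r with hf
  obtain ⟨y, s, hys⟩ := exists_joinLast ((A.coord r).linearIsometryEquiv.symm w)
  have hw : w = (A.coord r).linearIsometryEquiv (joinLast y s) := by rw [← hys]; simp
  have hd := differentiableAt_fn hA hk r hx
  rw [← hf] at hd
  have hpt : ∀ ε : ℝ, A.bdryPt r x + ε • w =
      A.coord r (joinLast (x + ε • y) (f x + ε * s)) := by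
    intro ε
    have h := (A.coord r).map_vadd (joinLast x (f x)) (ε • joinLast y s)
    rw [vadd_eq_add, vadd_eq_add, map_smul, ← hw] at h
    rw [joinLast_add_smul, bdryPt, ← hf, add_comm (joinLast x (f x)), h]
    exact add_comm _ _
  have hin : inner ℝ w (A.localNormal r x) =
      (√(1 + ‖gradient f x‖ ^ 2))⁻¹ * (fderiv ℝ f x y - s) := by
    rw [hw, localNormal, LinearIsometryEquiv.inner_map_map, inner_smul_right, inner_joinLast,
      ← hf, real_inner_comm, gradient, InnerProductSpace.toDual_symm_apply]
    ring
  have hpos : 0 < (√(1 + ‖gradient f x‖ ^ 2))⁻¹ := by positivity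
  have hline : HasDerivAt (fun ε : ℝ => x + ε • y) y 0 := by
    simpa using ((hasDerivAt_id (0 : ℝ)).smul_const y).const_add x
  have hder : HasDerivAt (fun ε : ℝ => f (x + ε • y)) (fderiv ℝ f x y) 0 := by
    have h0 : HasFDerivAt f (fderiv ℝ f x) (x + (0 : ℝ) • y) := by simpa using hd.hasFDerivAt
    exact h0.comp_hasDerivAt (0 : ℝ) hline
  have hcube : ∀ᶠ ε in 𝓝[>] (0 : ℝ), x + ε • y ∈ openCube n A.a := by
    have : Tendsto (fun ε : ℝ => x + ε • y) (𝓝 0) (𝓝 x) := by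
      simpa using hline.continuousAt.tendsto
    exact (this.mono_left nhdsWithin_le_nhds) (openCube_mem_nhds hx)
  have hdiff : Tendsto (fun ε : ℝ => f x + ε * s - f (x + ε • y)) (𝓝[>] 0) (𝓝 0) := by
    have : ContinuousAt (fun ε : ℝ => f x + ε * s - f (x + ε • y)) 0 :=
      (by fun_prop : ContinuousAt (fun ε : ℝ => f x + ε * s) 0).sub hder.continuousAt
    have h2 := this.tendsto
    simp only [zero_mul, add_zero, zero_smul, sub_self] at h2
    exact h2.mono_left nhdsWithin_le_nhds
  have hslope : Tendsto (fun ε : ℝ => ε⁻¹ * (f (x + ε • y) - f x)) (𝓝[>] 0)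
      (𝓝 (fderiv ℝ f x y)) := by
    have := hder.tendsto_slope_zero_right
    simpa using this
  constructor
  · intro h
    have hlt : fderiv ℝ f x y < s := by
      rw [hin] at h; nlinarith [(mul_neg_iff.1 h).resolve_right (by intro h'; linarith [h'.1])]
    filter_upwards [hcube, hslope.eventually_lt_const hlt, hdiff.eventually_lt_const A.b_pos,
      self_mem_nhdsWithin] with ε h1 h2 h3 h4
    have h5 : f (x + ε • y) - f x < ε * s := by
      rwa [inv_mul_lt_iff₀ h4] at h2
    have : A.bdryPt r x + ε • w ∈ V ∩ Ω := by
      rw [hV2]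
      exact ⟨x + ε • y, h1, f x + ε * s, by linarith, by linarith, hpt ε⟩
    exact this.2
  · intro h
    have hlt : s < fderiv ℝ f x y := by
      rw [hin] at h
      linarith [pos_of_mul_pos_right h hpos.le]
    filter_upwards [hcube, hslope.eventually_const_lt hlt,
      hdiff.eventually_const_lt (neg_lt_zero.2 A.b_pos),
      self_mem_nhdsWithin] with ε h1 h2 h3 h4
    have h5 : ε * s < f (x + ε • y) - f x := by
      rwa [lt_inv_mul_iff₀ h4] at h2
    have : A.bdryPt r x + ε • w ∈ V ∩ (closure Ω)ᶜ := by
      rw [hV3]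
      exact ⟨x + ε • y, h1, f x + ε * s, by linarith, by linarith, hpt ε⟩
    exact this.2

/-- In every chart the outer normal is given by the local formula. -/
theorem outerNormal_bdryPt {A : GraphSystem Ω} {k : ℕ} {μ : ℝ≥0} (hA : A.IsOfClass k μ)
    (hk : 1 ≤ k) (r : Fin A.m) {x : Euc n} (hx : x ∈ openCube n A.a) :
    A.outerNormal (A.bdryPt r x) = A.localNormal r x := by
  have h : ∃ q : Fin A.m × Euc n, q.2 ∈ openCube n A.a ∧ A.bdryPt r x = A.bdryPt q.1 q.2 :=
    ⟨(r, x), hx, rfl⟩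
  rw [outerNormal, dif_pos h]
  obtain ⟨hq, hz⟩ := h.choose_spec
  generalize h.choose = q at hq hz
  by_contra hne
  set N := A.localNormal r x with hN
  set M := A.localNormal q.1 q.2 with hM
  have hN1 : inner ℝ N N = (1 : ℝ) := by
    rw [real_inner_self_eq_norm_sq, norm_localNormal]; norm_num
  have hM1 : inner ℝ M M = (1 : ℝ) := by
    rw [real_inner_self_eq_norm_sq, norm_localNormal]; norm_num
  have hlt : inner ℝ M N < (1 : ℝ) :=
    (inner_lt_one_iff_real_of_norm_eq_one (norm_localNormal A _ _)
      (norm_localNormal A _ _)).2 hne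
  have e1 := (localNormal_side hA hk r hx (M - N)).1 (by
    rw [← hN, inner_sub_left]; linarith)
  have e2 := (localNormal_side hA hk q.1 hq (M - N)).2 (by
    rw [← hM, inner_sub_left, real_inner_comm M N]; linarith)
  rw [← hz] at e2
  obtain ⟨ε, h1, h2⟩ := (e1.and e2).exists
  exact h2 (subset_closure h1)

end GraphSystem

end

/-! Everything rests on an identity on a segment of length `δ` entering `Ω` from a boundary point:
`δ g(0) = ∫₀^δ (g(t) - (δ - t) g'(t)) dt`. Jensen's inequality and convexity turn it into `|g(0)|^p
≤ 2^(p-1) (δ⁻¹ ∫ |g|^p + δ^(p-1) ∫ |g'|^p)` (`enorm_rpow_le_lintegral`). In a chart the vertical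
segments above the graph stay in `Ω` as long as `δ < b`, and the shear `(x, t) ↦ (x, f x + t)`
preserves volume, so integrating over the cube bounds the boundary norm of a smooth `w` by the norms
of `w` and its gradient on `Ω`. If `X ≤ Y` bound these two norms, taking `δ` proportional to `X / Y`
balances the two terms and gives the multiplicative inequality with right side `K X^((p-1)/p)
Y^(1/p)` (`GraphSystem.exists_eLpNorm_bdryPt_le`).

To leave the smooth case, functions smooth on the whole space are shown to be dense in `W^{1,p}(Ω)`
(`exists_smooth_approx`): a graph boundary lets `Ω` be pushed locally into itself, so with a
partition of unity each piece can be mollified after a small inward shift, without seeing values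
outside `Ω`. The relation `IsTraceOf` describes a trace as a limit of smooth restrictions. The
inequality passes to such limits, which makes them unique; completeness of `L^p` on the boundary
makes them exist. Hence a trace map exists, and each trace map is given by these limits, so the
constant does not depend on the map.

Finally the inequality is applied to the functions `∂_j u`. Their `L^p` norm is at most the
`W^{1,p}` norm of `u`, their `W^{1,p}` norm is at most a constant times the `W^{2,p}` norm of `u`,
and the components of `ν` have absolute value at most one. -/

open GraphSystem

/-! ## Classical and weak partial derivatives -/

section Classical

variable {d : ℕ}

theorem contDiff_partialD {φ : Euc d → ℝ} (hφ : ContDiff ℝ ∞ φ) (j : Fin d) :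
    ContDiff ℝ ∞ (partialD j φ) :=
  (hφ.fderiv_right (m := ∞) (by simp)).clm_apply contDiff_const

theorem contDiff_iterate_partialD {φ : Euc d → ℝ} (hφ : ContDiff ℝ ∞ φ) (j : Fin d) (k : ℕ) :
    ContDiff ℝ ∞ ((partialD j)^[k] φ) := by
  induction k with
  | zero => exact hφ
  | succ k ih => rw [Function.iterate_succ_apply']; exact contDiff_partialD ih j

theorem contDiff_foldr_partialD {φ : Euc d → ℝ} (hφ : ContDiff ℝ ∞ φ) (α : Fin d → ℕ)
    (l : List (Fin d)) :
    ContDiff ℝ ∞ (l.foldr (fun j g => (partialD j)^[α j] g) φ) := by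
  induction l with
  | nil => exact hφ
  | cons i l ih => exact contDiff_iterate_partialD ih i _

theorem partialD_comm {φ : Euc d → ℝ} (hφ : ContDiff ℝ ∞ φ) (i j : Fin d) :
    partialD i (partialD j φ) = partialD j (partialD i φ) := by
  have hd : Differentiable ℝ (fderiv ℝ φ) :=
    (hφ.fderiv_right (m := ∞) (by simp)).differentiable (by simp)
  have key : ∀ i j x, partialD i (partialD j φ) x =
      fderiv ℝ (fderiv ℝ φ) x (EuclideanSpace.single i 1) (EuclideanSpace.single j 1) := by
    intro i j x
    change fderiv ℝ (fun y => fderiv ℝ φ y (EuclideanSpace.single j 1)) x _ = _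
    rw [fderiv_clm_apply (hd x) (differentiableAt_const _)]
    simp
  ext x
  rw [key, key]
  exact (hφ.contDiffAt.isSymmSndFDerivAt (by
    rw [minSmoothness_of_isRCLikeNormedField]; exact WithTop.coe_le_coe.2 le_top)).eq _ _

theorem iterate_partialD_comm {φ : Euc d → ℝ} (hφ : ContDiff ℝ ∞ φ) (i j : Fin d) (k : ℕ) :
    (partialD i)^[k] (partialD j φ) = partialD j ((partialD i)^[k] φ) := by
  induction k with
  | zero => rfl
  | succ k ih =>
    rw [Function.iterate_succ_apply', ih, Function.iterate_succ_apply',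
      partialD_comm (contDiff_iterate_partialD hφ i k)]

/-- `multiD` applies the partial derivatives in a fixed order, so raising the exponent at `j`
inserts one `∂_j` in the middle of the composition. Symmetry of second derivatives moves it to the
front; without duplicates in the list it is inserted at most once. -/
theorem foldr_partialD_add_single {φ : Euc d → ℝ} (hφ : ContDiff ℝ ∞ φ) (α : Fin d → ℕ)
    (j : Fin d) (l : List (Fin d)) (hl : l.Nodup) :
    l.foldr (fun i g => (partialD i)^[(α + Pi.single j 1 : Fin d → ℕ) i] g) φ =
      if j ∈ l then partialD j (l.foldr (fun i g => (partialD i)^[α i] g) φ)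
      else l.foldr (fun i g => (partialD i)^[α i] g) φ := by
  induction l with
  | nil => simp
  | cons i l ih =>
    rw [List.nodup_cons] at hl
    rw [List.foldr_cons, List.foldr_cons, ih hl.2]
    by_cases hij : j = i
    · subst hij
      simp [hl.1, ← Function.iterate_succ_apply' (partialD j)]
    · by_cases hjl : j ∈ l
      · simp [hij, hjl, Ne.symm hij,
          iterate_partialD_comm (contDiff_foldr_partialD hφ α l)]
      · simp [hij, hjl, Ne.symm hij]

theorem multiD_add_single {φ : Euc d → ℝ} (hφ : ContDiff ℝ ∞ φ) (α : Fin d → ℕ) (j : Fin d) :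
    multiD (α + Pi.single j 1) φ = partialD j (multiD α φ) := by
  have h := foldr_partialD_add_single hφ α j (List.finRange d) (List.nodup_finRange d)
  rwa [if_pos (List.mem_finRange j)] at h

theorem foldr_partialD_zero (φ : Euc d → ℝ) (l : List (Fin d)) :
    l.foldr (fun j g => (partialD j)^[(0 : Fin d → ℕ) j] g) φ = φ := by
  induction l with
  | nil => rfl
  | cons i l ih => simp

theorem multiD_zero (φ : Euc d → ℝ) : multiD 0 φ = φ := foldr_partialD_zero φ _

theorem multiD_single {φ : Euc d → ℝ} (hφ : ContDiff ℝ ∞ φ) (j : Fin d) :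
    multiD (Pi.single j 1) φ = partialD j φ := by
  have := multiD_add_single hφ 0 j
  rwa [zero_add, multiD_zero] at this

theorem contDiff_multiD {φ : Euc d → ℝ} (hφ : ContDiff ℝ ∞ φ) (α : Fin d → ℕ) :
    ContDiff ℝ ∞ (multiD α φ) := contDiff_foldr_partialD hφ α _

theorem tsupport_partialD_subset (φ : Euc d → ℝ) (j : Fin d) :
    tsupport (partialD j φ) ⊆ tsupport φ :=
  tsupport_fderiv_apply_subset ℝ _

theorem tsupport_multiD_subset (φ : Euc d → ℝ) (α : Fin d → ℕ) :
    tsupport (multiD α φ) ⊆ tsupport φ := by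
  have hit : ∀ (g : Euc d → ℝ) (i : Fin d) (k : ℕ),
      tsupport ((partialD i)^[k] g) ⊆ tsupport g := by
    intro g i k
    induction k with
    | zero => exact subset_rfl
    | succ k ih =>
      rw [Function.iterate_succ_apply']
      exact (tsupport_partialD_subset _ _).trans ih
  have : ∀ l : List (Fin d),
      tsupport (l.foldr (fun i g => (partialD i)^[α i] g) φ) ⊆ tsupport φ := by
    intro l
    induction l with
    | nil => exact subset_rfl
    | cons i l ih => exact (hit _ _ _).trans ih
  exact this _

end Classical

/-! ### Weak derivatives: uniqueness, linearity, iteration. -/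

section Weak

variable {d : ℕ} {Ω : Set (Euc d)} {α : Fin d → ℕ} {u v u' v' : Euc d → ℂ}

theorem _root_.MeasureTheory.LocallyIntegrableOn.integrable_continuous_smul
    (hu : LocallyIntegrableOn u Ω) {φ : Euc d → ℝ} (hφ : Continuous φ)
    (hc : HasCompactSupport φ) (hs : tsupport φ ⊆ Ω) :
    Integrable (fun x => φ x • u x) (volume.restrict Ω) := by
  have h1 : IntegrableOn (fun x => φ x • u x) (tsupport φ) :=
    (hu.integrableOn_compact_subset hs hc).continuousOn_smul hφ.continuousOn hc
  have h2 : Integrable (fun x => φ x • u x) :=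
    (integrableOn_iff_integrable_of_support_subset
      ((Function.support_smul_subset_left φ u).trans (subset_tsupport φ))).1 h1
  exact h2.integrableOn

/-- This is the fundamental lemma of the calculus of variations applied to `v - v'`. It makes the
arbitrary choice in `weakD` harmless. -/
theorem HasWeakD.ae_eq (hΩ : IsOpen Ω) (h : HasWeakD Ω α u v) (h' : HasWeakD Ω α u v') :
    v =ᵐ[volume.restrict Ω] v' := by
  have key := hΩ.ae_eq_zero_of_integral_contDiff_smul_eq_zero (μ := volume)
    (h.2.1.sub h'.2.1) ?_
  · rw [EventuallyEq, ae_restrict_iff' hΩ.measurableSet]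
    filter_upwards [key] with x hx hxΩ
    exact sub_eq_zero.1 (hx hxΩ)
  · intro φ h1 h2 h3
    have e1 := h.2.2 φ h1 h2 h3
    rw [h'.2.2 φ h1 h2 h3] at e1
    have e2 : ∫ x in Ω, φ x • v x = ∫ x in Ω, φ x • v' x :=
      (mul_left_cancel₀ (pow_ne_zero _ (by norm_num)) e1).symm
    have hi := h.2.1.integrable_continuous_smul h1.continuous h2 h3
    have hi' := h'.2.1.integrable_continuous_smul h1.continuous h2 h3
    rw [← setIntegral_eq_integral_of_forall_compl_eq_zero (s := Ω)]
    · simp only [Pi.sub_apply, smul_sub]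
      rw [integral_sub hi hi', e2, sub_self]
    · intro x hx
      rw [image_eq_zero_of_notMem_tsupport (fun hh => hx (h3 hh)), zero_smul]

theorem hasWeakD_zero (hu : LocallyIntegrableOn u Ω) : HasWeakD Ω 0 u u :=
  ⟨hu, hu, fun φ _ _ _ => by simp [multiD_zero]⟩

theorem HasWeakD.add (h : HasWeakD Ω α u v) (h' : HasWeakD Ω α u' v') :
    HasWeakD Ω α (u + u') (v + v') := by
  refine ⟨h.1.add h'.1, h.2.1.add h'.2.1, fun φ h1 h2 h3 => ?_⟩
  have hm := contDiff_multiD h1 α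
  have hs := (tsupport_multiD_subset φ α)
  have hc : HasCompactSupport (multiD α φ) := h2.of_isClosed_subset (isClosed_tsupport _) hs
  simp only [Pi.add_apply, smul_add]
  rw [integral_add (h.1.integrable_continuous_smul hm.continuous hc (hs.trans h3))
      (h'.1.integrable_continuous_smul hm.continuous hc (hs.trans h3)),
    integral_add (h.2.1.integrable_continuous_smul h1.continuous h2 h3)
      (h'.2.1.integrable_continuous_smul h1.continuous h2 h3),
    h.2.2 φ h1 h2 h3, h'.2.2 φ h1 h2 h3, mul_add]

theorem HasWeakD.const_smul (h : HasWeakD Ω α u v) (c : ℂ) :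
    HasWeakD Ω α (c • u) (c • v) := by
  refine ⟨h.1.smul c, h.2.1.smul c, fun φ h1 h2 h3 => ?_⟩
  simp only [Pi.smul_apply, smul_comm _ c]
  rw [integral_smul, integral_smul, h.2.2 φ h1 h2 h3, smul_eq_mul, smul_eq_mul]
  ring

theorem HasWeakD.weakD (h : HasWeakD Ω α u v) : HasWeakD Ω α u (weakD Ω α u) := by
  have : ∃ v, HasWeakD Ω α u v := ⟨v, h⟩
  rw [_root_.weakD, dif_pos this]
  exact this.choose_spec

theorem HasWeakD.weakD_ae_eq (hΩ : IsOpen Ω) (h : HasWeakD Ω α u v) :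
    _root_.weakD Ω α u =ᵐ[volume.restrict Ω] v := h.weakD.ae_eq hΩ h

/-- If `v = ∂_j u` and `w = ∂^{α + e_j} u` weakly, then `w = ∂^α v` weakly. -/
theorem HasWeakD.of_add_single {w : Euc d → ℂ} {j : Fin d} (h : HasWeakD Ω (Pi.single j 1) u v)
    (h' : HasWeakD Ω (α + Pi.single j 1) u w) : HasWeakD Ω α v w := by
  refine ⟨h.2.1, h'.2.1, fun φ h1 h2 h3 => ?_⟩
  have hm := contDiff_multiD h1 α
  have hs := (tsupport_multiD_subset φ α)
  have hc : HasCompactSupport (multiD α φ) := h2.of_isClosed_subset (isClosed_tsupport _) hs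
  have e1 := h.2.2 (multiD α φ) hm hc (hs.trans h3)
  have e2 := h'.2.2 φ h1 h2 h3
  rw [multiD_single hm, ← multiD_add_single h1, e2] at e1
  simp only [Pi.add_apply, Finset.sum_add_distrib, Finset.sum_pi_single', Finset.mem_univ,
    if_true, pow_add, pow_one] at e1
  linear_combination e1

/-- A smooth function has its classical partial derivatives as weak derivatives. -/
theorem ContDiff.hasWeakD_single {w : Euc d → ℂ} (hw : ContDiff ℝ ∞ w) (j : Fin d) :
    HasWeakD Ω (Pi.single j 1) w (fun x => fderiv ℝ w x (EuclideanSpace.single j 1)) := by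
  have hw' : Continuous (fun x => fderiv ℝ w x (EuclideanSpace.single j (1 : ℝ))) :=
    (hw.continuous_fderiv (by simp)).clm_apply continuous_const
  refine ⟨hw.continuous.locallyIntegrable.locallyIntegrableOn _,
    hw'.locallyIntegrable.locallyIntegrableOn _, fun φ h1 h2 h3 => ?_⟩
  rw [multiD_single h1]
  have hz : ∀ x, x ∉ Ω → φ x = 0 := fun x hx =>
    image_eq_zero_of_notMem_tsupport (fun hh => hx (h3 hh))
  have hz' : ∀ x, x ∉ Ω → partialD j φ x = 0 := fun x hx =>
    image_eq_zero_of_notMem_tsupport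
      (fun hh => hx (h3 (tsupport_partialD_subset φ j hh)))
  -- Both integrands vanish off `Ω`, so integration by parts takes place on the whole space and
  -- produces no boundary term.
  rw [setIntegral_eq_integral_of_forall_compl_eq_zero (fun x hx => by rw [hz' x hx, zero_smul]),
    setIntegral_eq_integral_of_forall_compl_eq_zero (fun x hx => by rw [hz x hx, zero_smul])]
  have hc : HasCompactSupport (partialD j φ) :=
    h2.of_isClosed_subset (isClosed_tsupport _) (tsupport_partialD_subset φ j)
  have hp := contDiff_partialD h1 j
  have := integral_bilinear_fderiv_right_eq_neg_left_of_integrable (μ := (volume : Measure (Euc d)))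
    (f := φ) (g := w) (v := EuclideanSpace.single j (1 : ℝ)) (B := ContinuousLinearMap.lsmul ℝ ℝ)
    ((hp.continuous.smul hw.continuous).integrable_of_hasCompactSupport hc.smul_right)
    ((h1.continuous.smul hw').integrable_of_hasCompactSupport h2.smul_right)
    ((h1.continuous.smul hw.continuous).integrable_of_hasCompactSupport h2.smul_right)
    (fun x _ => h1.differentiable (by simp) x) (fun x _ => hw.differentiable (by simp) x)
  simp only [ContinuousLinearMap.lsmul_apply] at this
  rw [this]
  simp [partialD]

end Weak

/-! ## Mollification -/

section Mollification

variable {d : ℕ} {P : ℝ≥0∞}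

/-- Translations are continuous in `L^p`. -/
theorem tendsto_eLpNorm_translate_sub {f : Euc d → ℂ} (hf : MemLp f P) (hP1 : 1 ≤ P)
    (hP : P ≠ ⊤) : Tendsto (fun y : Euc d => eLpNorm (fun x => f (x - y) - f x) P volume)
      (𝓝 0) (𝓝 0) := by
  have : Fact (1 ≤ P) := ⟨hP1⟩
  have hmp : ∀ y : Euc d, MeasurePreserving (fun x : Euc d => x - y) volume volume :=
    fun y => measurePreserving_sub_right volume y
  -- The translations form a continuous family of measure preserving maps, and composition with such
  -- a family acts continuously on `L^p` for finite exponents.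
  let g : Euc d → C(Euc d, Euc d) := fun y => ⟨fun x => x - y, by fun_prop⟩
  have hg : Continuous g := ContinuousMap.continuous_of_continuous_uncurry _
    (continuous_snd.sub continuous_fst)
  have h := (continuous_const (y := hf.toLp f)).compMeasurePreservingLp
    (ν := (volume : Measure (Euc d))) hg hmp hP
  have h0 := h.tendsto 0
  rw [tendsto_iff_edist_tendsto_0] at h0
  refine h0.congr fun y => ?_
  rw [Lp.edist_def]
  refine eLpNorm_congr_ae ?_
  have e1 := Lp.coeFn_compMeasurePreserving (hf.toLp f) (hmp y)
  have e2 := Lp.coeFn_compMeasurePreserving (hf.toLp f) (hmp 0)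
  have e3 := (hmp y).quasiMeasurePreserving.ae_eq_comp hf.coeFn_toLp
  have e4 := (hmp 0).quasiMeasurePreserving.ae_eq_comp hf.coeFn_toLp
  refine ((e1.trans e3).sub (e2.trans e4)).trans (ae_of_all _ fun x => ?_)
  simp

/-- **Jensen's inequality** for the `L^p` norm of an average. -/
theorem enorm_integral_rpow_le {X : Type*} [MeasurableSpace X] {m : Measure X}
    [IsProbabilityMeasure m] {g : X → ℂ} (hg : AEStronglyMeasurable g m) {p : ℝ} (hp : 1 ≤ p) :
    ‖∫ y, g y ∂m‖ₑ ^ p ≤ ∫⁻ y, ‖g y‖ₑ ^ p ∂m := by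
  have h1 : ‖∫ y, g y ∂m‖ₑ ≤ eLpNorm g (ENNReal.ofReal p) m := by
    refine (enorm_integral_le_lintegral_enorm g).trans ?_
    rw [← eLpNorm_one_eq_lintegral_enorm]
    exact eLpNorm_le_eLpNorm_of_exponent_le (by simpa using hp) hg
  have hp0 : 0 < p := by linarith
  calc ‖∫ y, g y ∂m‖ₑ ^ p ≤ (eLpNorm g (ENNReal.ofReal p) m) ^ p := by gcongr
    _ = _ := by
      rw [eLpNorm_eq_lintegral_rpow_enorm_toReal (by simpa using hp0) (by simp),
        ENNReal.toReal_ofReal hp0.le, ← ENNReal.rpow_mul]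
      simp [hp0.ne']

/-- The function `x ↦ ∫ f(x - y) φ(y) dy`. -/
noncomputable def mollify (φ : Euc d → ℝ) (f : Euc d → ℂ) : Euc d → ℂ :=
  convolution φ f (ContinuousLinearMap.lsmul ℝ ℝ) volume

/-- The difference `mollify φ f - f` is the average of `f (· - y) - f` for the probability measure
`φ(y) dy`. Jensen's inequality and Tonelli's theorem reduce it to the translates with `y` in the
support of `φ`. The kernel need not be centred at the origin, which leaves room for inward shifts.
-/
theorem eLpNorm_mollify_sub_le {f : Euc d → ℂ} (hf : LocallyIntegrable f) {φ : Euc d → ℝ}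
    (hφc : Continuous φ) (hφs : HasCompactSupport φ) (hφ0 : ∀ x, 0 ≤ φ x) (hφ1 : ∫ x, φ x = 1)
    {p : ℝ} (hp : 1 ≤ p) {ε : ℝ≥0∞}
    (hε : ∀ y ∈ tsupport φ, eLpNorm (fun x => f (x - y) - f x) (ENNReal.ofReal p) volume ≤ ε) :
    eLpNorm (fun x => mollify φ f x - f x) (ENNReal.ofReal p) volume ≤ ε := by
  have hp0 : 0 < p := by linarith
  set m : Measure (Euc d) := volume.withDensity (fun y => ENNReal.ofReal (φ y)) with hm
  have hφi : Integrable φ := hφc.integrable_of_hasCompactSupport hφs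
  have hφm : Measurable (fun y => ENNReal.ofReal (φ y)) := by fun_prop
  have : IsProbabilityMeasure m := ⟨by
    rw [hm, withDensity_apply _ MeasurableSet.univ, Measure.restrict_univ,
      ← ofReal_integral_eq_lintegral_ofReal hφi (ae_of_all _ hφ0), hφ1, ENNReal.ofReal_one]⟩
  have hmac : m ≪ volume := withDensity_absolutelyContinuous _ _
  have hsupp : ∀ᵐ y ∂m, y ∈ tsupport φ := by
    rw [hm, ae_withDensity_iff hφm]
    refine ae_of_all _ fun y hy => subset_tsupport _ ?_
    intro h0
    simp [h0] at hy
  have hfm : AEStronglyMeasurable f volume := hf.aestronglyMeasurable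
  -- Joint measurability is needed for Tonelli's theorem; it is inherited from the product of
  -- Lebesgue measures because `m` is absolutely continuous.
  have hmeas2 : AEStronglyMeasurable (fun z : Euc d × Euc d => f (z.1 - z.2) - f z.1)
      (volume.prod m) := by
    have h1 : AEStronglyMeasurable (fun z : Euc d × Euc d => f (z.1 - z.2))
        (volume.prod (volume : Measure (Euc d))) :=
      hfm.comp_quasiMeasurePreserving (quasiMeasurePreserving_sub volume volume)
    have h2 : volume.prod m ≪ (volume : Measure (Euc d)).prod (volume : Measure (Euc d)) :=
      Measure.AbsolutelyContinuous.rfl.prod hmac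
    exact (h1.mono_ac h2).sub (hfm.comp_fst)
  have hpt : ∀ᵐ x : Euc d, ‖mollify φ f x - f x‖ₑ ^ p ≤ ∫⁻ y, ‖f (x - y) - f x‖ₑ ^ p ∂m := by
    filter_upwards [hmeas2.prodMk_left] with x hx
    have hsm : Integrable (fun y => φ y • f (x - y)) :=
      hφs.convolutionExists_left (ContinuousLinearMap.lsmul ℝ ℝ) hφc hf x
    have e : mollify φ f x - f x = ∫ y, (f (x - y) - f x) ∂m := by
      rw [hm, integral_withDensity_eq_integral_toReal_smul hφm (ae_of_all _ fun _ => by simp)]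
      simp only [ENNReal.toReal_ofReal (hφ0 _), smul_sub]
      rw [integral_sub hsm (hφi.smul_const _), integral_smul_const, hφ1, one_smul]
      rfl
    rw [e]
    exact enorm_integral_rpow_le hx hp
  rw [eLpNorm_eq_lintegral_rpow_enorm_toReal (by simpa using hp0) (by simp),
    ENNReal.toReal_ofReal hp0.le, one_div, ENNReal.rpow_inv_le_iff hp0]
  calc ∫⁻ x, ‖mollify φ f x - f x‖ₑ ^ p
      ≤ ∫⁻ x, ∫⁻ y, ‖f (x - y) - f x‖ₑ ^ p ∂m := lintegral_mono_ae hpt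
    _ = ∫⁻ y, (∫⁻ x, ‖f (x - y) - f x‖ₑ ^ p) ∂m :=
        lintegral_lintegral_swap (hmeas2.enorm.pow_const p)
    _ ≤ ∫⁻ y, ε ^ p ∂m := by
        refine lintegral_mono_ae (hsupp.mono fun y hy => ?_)
        have := hε y hy
        rwa [eLpNorm_eq_lintegral_rpow_enorm_toReal (by simpa using hp0) (by simp),
          ENNReal.toReal_ofReal hp0.le, one_div, ENNReal.rpow_inv_le_iff hp0] at this
    _ = ε ^ p := by simp

theorem contDiff_mollify {f : Euc d → ℂ} (hf : LocallyIntegrable f) {φ : Euc d → ℝ}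
    (hφ : ContDiff ℝ ∞ φ) (hφs : HasCompactSupport φ) : ContDiff ℝ ∞ (mollify φ f) :=
  hφs.contDiff_convolution_left _ hφ hf

theorem fderiv_mollify {f : Euc d → ℂ} (hf : LocallyIntegrable f) {φ : Euc d → ℝ}
    (hφ : ContDiff ℝ ∞ φ) (hφs : HasCompactSupport φ) (x : Euc d) (j : Fin d) :
    fderiv ℝ (mollify φ f) x (EuclideanSpace.single j 1) = mollify (partialD j φ) f x := by
  have h := hφs.hasFDerivAt_convolution_left (ContinuousLinearMap.lsmul ℝ ℝ)
    (hφ.of_le (by simp)) hf x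
  have hex := (hφs.fderiv (𝕜 := ℝ)).convolutionExists_left
    ((ContinuousLinearMap.lsmul ℝ ℝ : ℝ →L[ℝ] ℂ →L[ℝ] ℂ).precompL (Euc d))
    (hφ.continuous_fderiv (by simp)) hf x
  rw [mollify, h.fderiv, convolution_def, ContinuousLinearMap.integral_apply hex]
  rfl

/-- The derivative of the mollification is the mollification of the weak derivative, at points
where the mollification only uses values in `Ω`. -/
theorem fderiv_mollify_indicator {Ω : Set (Euc d)} (hΩ : MeasurableSet Ω) {u v : Euc d → ℂ}
    {j : Fin d} (h : HasWeakD Ω (Pi.single j 1) u v) (hu : LocallyIntegrable (Ω.indicator u))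
    {φ : Euc d → ℝ} (hφ : ContDiff ℝ ∞ φ) (hφs : HasCompactSupport φ) {x : Euc d}
    (hx : ∀ y ∈ tsupport φ, x - y ∈ Ω) :
    fderiv ℝ (mollify φ (Ω.indicator u)) x (EuclideanSpace.single j 1) =
      mollify φ (Ω.indicator v) x := by
  rw [fderiv_mollify hu hφ hφs]
  -- The reflected kernel is an admissible test function exactly because `x - y` stays in `Ω` on the
  -- support of `φ`. The sign from the reflection cancels the sign in the definition of the weak
  -- derivative.
  set ψ : Euc d → ℝ := fun y => φ (x - y) with hψ
  have hψ1 : ContDiff ℝ ∞ ψ := hφ.comp (contDiff_const.sub contDiff_id)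
  have hψt : tsupport ψ ⊆ (fun y => x - y) '' tsupport φ := by
    refine closure_minimal ?_ ?_
    · intro y hy
      exact ⟨x - y, subset_tsupport _ hy, by simp⟩
    · exact (hφs.isCompact.image (by fun_prop)).isClosed
  have hψc : HasCompactSupport ψ :=
    (hφs.isCompact.image (by fun_prop : Continuous fun y => x - y)).of_isClosed_subset
      (isClosed_tsupport _) hψt
  have hψΩ : tsupport ψ ⊆ Ω := by
    intro y hy
    obtain ⟨z, hz, rfl⟩ := hψt hy
    exact hx z hz
  have e := h.2.2 ψ hψ1 hψc hψΩ
  have hconv : ∀ (η : Euc d → ℝ) (g : Euc d → ℂ),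
      mollify η (Ω.indicator g) x = ∫ y in Ω, η (x - y) • g y := by
    intro η g
    rw [mollify, convolution_eq_swap, ← integral_indicator hΩ]
    refine integral_congr_ae (ae_of_all _ fun y => ?_)
    by_cases hy : y ∈ Ω <;> simp [hy]
  rw [hconv, hconv]
  rw [multiD_single hψ1] at e
  have hd : partialD j ψ = fun y => -partialD j φ (x - y) := by
    ext y
    simp only [partialD, hψ]
    have h1 : HasFDerivAt (fun y => φ (x - y))
        ((fderiv ℝ φ (x - y)).comp (-ContinuousLinearMap.id ℝ (Euc d))) y :=
      ((hφ.differentiable (by simp)) (x - y)).hasFDerivAt.comp y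
        ((hasFDerivAt_id y).const_sub x)
    rw [h1.fderiv]
    simp
  rw [hd] at e
  simp only [neg_smul, integral_neg, Finset.sum_pi_single', Finset.mem_univ, if_true, pow_one,
    neg_mul, one_mul, neg_inj] at e
  exact e

end Mollification

/-! ## Density of smooth functions -/

section Density

variable {d : ℕ} {Ω : Set (Euc d)}

/-- Near each point of its closure, `Ω` can be shifted into itself in a fixed direction. -/
def HasInwardShifts (Ω : Set (Euc d)) : Prop :=
  ∀ z ∈ closure Ω, ∃ V, IsOpen V ∧ z ∈ V ∧ ∃ v : Euc d, ∀ K ⊆ V, IsCompact K →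
    ∀ᶠ t in 𝓝[>] (0 : ℝ), ∀ x ∈ K ∩ closure Ω, x + t • v ∈ Ω

/-- A shifted mollifier which only uses values in `Ω` at the points of `K`. -/
theorem exists_shifted_mollifier (hΩ : IsOpen Ω) {K : Set (Euc d)} (hK : IsCompact K) {v : Euc d}
    (hv : ∀ᶠ t in 𝓝[>] (0 : ℝ), ∀ x ∈ K, x + t • v ∈ Ω) {η : ℝ} (hη : 0 < η) :
    ∃ φ : Euc d → ℝ, ContDiff ℝ ∞ φ ∧ HasCompactSupport φ ∧ (∀ x, 0 ≤ φ x) ∧ ∫ x, φ x = 1 ∧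
      (∀ y ∈ tsupport φ, ‖y‖ < η) ∧ ∀ x ∈ K, ∀ y ∈ tsupport φ, x - y ∈ Ω := by
  have hsmall : ∀ᶠ t in 𝓝[>] (0 : ℝ), ‖t • v‖ < η / 2 := by
    have : Tendsto (fun t : ℝ => ‖t • v‖) (𝓝 0) (𝓝 0) := by
      have h : Continuous fun t : ℝ => ‖t • v‖ := by fun_prop
      simpa using h.tendsto 0
    exact (this.mono_left nhdsWithin_le_nhds).eventually_lt_const (by positivity)
  obtain ⟨t, ht, htη⟩ := (hv.and hsmall).exists
  have hK' : IsCompact ((fun x => x + t • v) '' K) := hK.image (by fun_prop)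
  obtain ⟨δ, hδ, hδΩ⟩ := hK'.exists_cthickening_subset_open hΩ
    (by rintro _ ⟨x, hx, rfl⟩; exact ht x hx)
  set ρ := min δ (η / 4) with hρ
  have hρ0 : 0 < ρ := by positivity
  -- The bump is centred at `-(t • v)`: for `y` in its support, `x - y` is within `δ` of `x + t •
  -- v`, hence in `Ω`.
  let f : ContDiffBump (-(t • v)) := ⟨ρ / 2, ρ, by positivity, by linarith⟩
  refine ⟨f.normed volume, f.contDiff_normed, f.hasCompactSupport_normed, f.nonneg_normed,
    f.integral_normed, fun y hy => ?_, fun x hx y hy => ?_⟩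
  · rw [f.tsupport_normed_eq, Metric.mem_closedBall, dist_eq_norm] at hy
    have h1 : ‖y - -(t • v)‖ ≤ η / 4 := hy.trans (min_le_right _ _)
    have h2 : ‖y‖ ≤ ‖y - -(t • v)‖ + ‖t • v‖ := by
      simpa using norm_sub_le (y - -(t • v)) (t • v)
    linarith
  · rw [f.tsupport_normed_eq, Metric.mem_closedBall, dist_eq_norm] at hy
    refine hδΩ (Metric.mem_cthickening_of_dist_le _ (x + t • v) _ _ ⟨x, hx, rfl⟩ ?_)
    have h1 : ‖y - -(t • v)‖ ≤ δ := hy.trans (min_le_left _ _)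
    rw [dist_eq_norm, ← norm_neg]
    rwa [show -(x - y - (x + t • v)) = y - -(t • v) by module]

/-- Smooth functions on `ℝ^d` are dense in `W^{1,p}(Ω)`. -/
theorem exists_smooth_approx (hΩ : IsOpen Ω) (hb : Bornology.IsBounded Ω)
    (hs : HasInwardShifts Ω) {p : ℝ} (hp : 1 ≤ p) {u : Euc d → ℂ} {v : Fin d → Euc d → ℂ}
    (hu : MemLp u (ENNReal.ofReal p) (volume.restrict Ω))
    (huv : ∀ j, HasWeakD Ω (Pi.single j 1) u (v j))
    (hv : ∀ j, MemLp (v j) (ENNReal.ofReal p) (volume.restrict Ω)) {ε : ℝ} (hε : 0 < ε) :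
    ∃ w : Euc d → ℂ, ContDiff ℝ ∞ w ∧
      eLpNorm (fun x => u x - w x) (ENNReal.ofReal p) (volume.restrict Ω) ≤ ENNReal.ofReal ε ∧
      ∀ j, eLpNorm (fun x => v j x - fderiv ℝ w x (EuclideanSpace.single j 1))
        (ENNReal.ofReal p) (volume.restrict Ω) ≤ ENNReal.ofReal ε := by
  have hP1 : 1 ≤ ENNReal.ofReal p := by simpa using hp
  have hcl : IsCompact (closure Ω) := hb.isCompact_closure
  have hΩm := hΩ.measurableSet
  choose! V hVo hzV s hsV using hs
  obtain ⟨T, hT⟩ := hcl.elim_finite_subcover (fun z : closure Ω => V z) (fun z => hVo z z.2)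
    (fun z hz => mem_iUnion.2 ⟨⟨z, hz⟩, hzV z hz⟩)
  have hT' : closure Ω ⊆ ⋃ i : T, V i := fun z hz => by
    obtain ⟨i, hi, hzi⟩ := mem_iUnion₂.1 (hT hz)
    exact mem_iUnion.2 ⟨⟨i, hi⟩, hzi⟩
  obtain ⟨f, hf⟩ := SmoothPartitionOfUnity.exists_isSubordinate (modelWithCornersSelf ℝ (Euc d))
    isClosed_closure (fun i : T => V i) (fun i => hVo i i.1.2) hT'
  set χ : T → Euc d → ℝ := fun i => f i with hχ
  have hχd : ∀ i, ContDiff ℝ ∞ (χ i) := fun i => (f i).contMDiff.contDiff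
  have hχ1 : ∀ x ∈ closure Ω, ∑ i, χ i x = 1 := fun x hx => by
    rw [← f.sum_eq_one hx, finsum_eq_sum_of_fintype]
  have hχn : ∀ i x, ‖χ i x‖ ≤ 1 := fun i x => by
    rw [Real.norm_of_nonneg (f.nonneg i x)]; exact f.le_one i x
  have hχc : ∀ i j, Continuous fun x => fderiv ℝ (χ i) x (EuclideanSpace.single j (1 : ℝ)) :=
    fun i j => ((hχd i).continuous_fderiv (by simp)).clm_apply continuous_const
  have hMij : ∀ q : T × Fin d, ∃ C, ∀ x ∈ closure Ω,
      ‖fderiv ℝ (χ q.1) x (EuclideanSpace.single q.2 (1 : ℝ))‖ ≤ C := fun q =>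
    hcl.exists_bound_of_continuousOn (hχc q.1 q.2).continuousOn
  choose Mq hMq using hMij
  obtain ⟨M, hM0, hM⟩ : ∃ M : ℝ, 0 ≤ M ∧ ∀ i j, ∀ x ∈ closure Ω,
      ‖fderiv ℝ (χ i) x (EuclideanSpace.single j (1 : ℝ))‖ ≤ M := by
    refine ⟨∑ q, |Mq q|, by positivity, fun i j x hx => ?_⟩
    exact (hMq (i, j) x hx).trans ((le_abs_self _).trans
      (Finset.single_le_sum (f := fun q => |Mq q|) (fun q _ => abs_nonneg _)
        (Finset.mem_univ (i, j))))
  set N : ℝ := (Fintype.card T : ℝ) with hN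
  -- Each of the `N` pieces will contribute an error of at most `M * δ + δ`, where `M` bounds the
  -- derivatives of the cutoffs. The last `+ 1` keeps the denominator positive.
  set δ : ℝ := ε / (N * (M + 1) + 1) with hδ
  have hδ0 : 0 < δ := by positivity
  -- The extensions by zero serve only as elements of `L^p`; no weak derivative across the boundary
  -- is claimed.
  set U := Ω.indicator u with hU
  set W : Fin d → Euc d → ℂ := fun j => Ω.indicator (v j) with hW
  have hUp : MemLp U (ENNReal.ofReal p) := (memLp_indicator_iff_restrict hΩm).2 hu
  have hWp : ∀ j, MemLp (W j) (ENNReal.ofReal p) := fun j =>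
    (memLp_indicator_iff_restrict hΩm).2 (hv j)
  have hUl : LocallyIntegrable U := hUp.locallyIntegrable hP1
  have hWl : ∀ j, LocallyIntegrable (W j) := fun j => (hWp j).locallyIntegrable hP1
  have hδ' : (0 : ℝ≥0∞) < ENNReal.ofReal δ := by simpa using hδ0
  have hev : ∀ᶠ y : Euc d in 𝓝 0,
      eLpNorm (fun x => U (x - y) - U x) (ENNReal.ofReal p) volume ≤ ENNReal.ofReal δ ∧
      ∀ j, eLpNorm (fun x => W j (x - y) - W j x) (ENNReal.ofReal p) volume
        ≤ ENNReal.ofReal δ :=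
    ((tendsto_eLpNorm_translate_sub hUp hP1 (by simp)).eventually_le_const hδ').and
      (eventually_all.2 fun j =>
        (tendsto_eLpNorm_translate_sub (hWp j) hP1 (by simp)).eventually_le_const hδ')
  obtain ⟨η, hη, hηs⟩ := Metric.eventually_nhds_iff.1 hev
  have hmol : ∀ i : T, ∃ φ : Euc d → ℝ, ContDiff ℝ ∞ φ ∧ HasCompactSupport φ ∧ (∀ x, 0 ≤ φ x) ∧
      ∫ x, φ x = 1 ∧ (∀ y ∈ tsupport φ, ‖y‖ < η) ∧
      ∀ x ∈ tsupport (χ i) ∩ closure Ω, ∀ y ∈ tsupport φ, x - y ∈ Ω := fun i => by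
    have hKc : IsCompact (tsupport (χ i) ∩ closure Ω) :=
      hcl.inter_left (isClosed_tsupport _)
    refine exists_shifted_mollifier hΩ hKc (v := s i) ?_ hη
    filter_upwards [hsV i i.1.2 _ (inter_subset_left.trans (hf i)) hKc] with t ht x hx
    exact ht x ⟨hx, hx.2⟩
  choose φ hφd hφc hφ0 hφ1 hφη hφΩ using hmol
  set E : T → Euc d → ℂ := fun i x => mollify (φ i) U x - U x with hE
  set F : T → Fin d → Euc d → ℂ := fun i j x => mollify (φ i) (W j) x - W j x with hF
  have hmd : ∀ i, ContDiff ℝ ∞ (mollify (φ i) U) := fun i =>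
    contDiff_mollify hUl (hφd i) (hφc i)
  have hEn : ∀ i, eLpNorm (E i) (ENNReal.ofReal p) (volume.restrict Ω) ≤ ENNReal.ofReal δ :=
    fun i => (eLpNorm_mono_measure _ Measure.restrict_le_self).trans
      (eLpNorm_mollify_sub_le hUl (hφd i).continuous (hφc i) (hφ0 i) (hφ1 i) hp fun y hy =>
        (hηs (by simpa using hφη i y hy)).1)
  have hFn : ∀ i j, eLpNorm (F i j) (ENNReal.ofReal p) (volume.restrict Ω) ≤ ENNReal.ofReal δ :=
    fun i j => (eLpNorm_mono_measure _ Measure.restrict_le_self).trans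
      (eLpNorm_mollify_sub_le (hWl j) (hφd i).continuous (hφc i) (hφ0 i) (hφ1 i) hp fun y hy =>
        (hηs (by simpa using hφη i y hy)).2 j)
  have hEm : ∀ i, AEStronglyMeasurable (E i) (volume.restrict Ω) := fun i =>
    ((hmd i).continuous.aestronglyMeasurable.sub hUl.aestronglyMeasurable).restrict
  have hFm : ∀ i j, AEStronglyMeasurable (F i j) (volume.restrict Ω) := fun i j =>
    ((contDiff_mollify (hWl j) (hφd i) (hφc i)).continuous.aestronglyMeasurable.sub
      (hWl j).aestronglyMeasurable).restrict
  have hNδ : Fintype.card T • (ENNReal.ofReal (M * δ + δ)) ≤ ENNReal.ofReal ε := by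
    rw [← ENNReal.ofReal_nsmul, nsmul_eq_mul]
    refine ENNReal.ofReal_le_ofReal ?_
    have : ε = δ * (N * (M + 1) + 1) := by
      rw [hδ, div_mul_cancel₀]; positivity
    nlinarith
  refine ⟨fun x => ∑ i, χ i x • mollify (φ i) U x,
    ContDiff.sum fun i _ => (hχd i).smul (hmd i), ?_, fun j => ?_⟩
  · have hpt : ∀ x ∈ Ω, u x - ∑ i, χ i x • mollify (φ i) U x = -∑ i, χ i x • E i x := by
      intro x hx
      have h1 := hχ1 x (subset_closure hx)
      simp only [hE, smul_sub, Finset.sum_sub_distrib, ← Finset.sum_smul, h1, one_smul, hU,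
        indicator_of_mem hx]
      ring
    calc eLpNorm (fun x => u x - ∑ i, χ i x • mollify (φ i) U x) (ENNReal.ofReal p)
          (volume.restrict Ω)
        ≤ eLpNorm (∑ i, fun x => ‖E i x‖) (ENNReal.ofReal p) (volume.restrict Ω) := by
          refine eLpNorm_mono_ae ?_
          filter_upwards [ae_restrict_mem hΩm] with x hx
          rw [hpt x hx, norm_neg, Finset.sum_apply, Real.norm_of_nonneg (by positivity)]
          refine (norm_sum_le _ _).trans (Finset.sum_le_sum fun i _ => ?_)
          rw [norm_smul]
          exact mul_le_of_le_one_left (norm_nonneg _) (hχn i x)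
      _ ≤ ∑ i, eLpNorm (fun x => ‖E i x‖) (ENNReal.ofReal p) (volume.restrict Ω) :=
          eLpNorm_sum_le (fun i _ => (hEm i).norm) hP1
      _ ≤ ∑ i : T, ENNReal.ofReal (M * δ + δ) := Finset.sum_le_sum fun i _ => by
          rw [eLpNorm_norm]
          exact (hEn i).trans (ENNReal.ofReal_le_ofReal (by nlinarith))
      _ ≤ ENNReal.ofReal ε := by simpa using hNδ
  · have hder : ∀ x ∈ Ω, fderiv ℝ (fun x => ∑ i, χ i x • mollify (φ i) U x) x
        (EuclideanSpace.single j 1) = ∑ i, (χ i x • mollify (φ i) (W j) x +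
          fderiv ℝ (χ i) x (EuclideanSpace.single j 1) • mollify (φ i) U x) := by
      intro x hx
      have hd1 : ∀ i, DifferentiableAt ℝ (χ i) x := fun i => (hχd i).differentiable (by simp) x
      have hd2 : ∀ i, DifferentiableAt ℝ (mollify (φ i) U) x := fun i =>
        (hmd i).differentiable (by simp) x
      rw [fderiv_fun_sum fun i _ => (hd1 i).fun_smul (hd2 i)]
      rw [_root_.sum_apply]
      refine Finset.sum_congr rfl fun i _ => ?_
      rw [fderiv_fun_smul (hd1 i) (hd2 i)]
      simp only [_root_.add_apply, _root_.smul_apply,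
        ContinuousLinearMap.smulRight_apply]
      congr 1
      -- Differentiation commutes with the mollification only where the kernel sees values in `Ω`,
      -- which is known on the support of `χ i`; elsewhere the factor `χ i x` vanishes.
      by_cases hxi : x ∈ tsupport (χ i)
      · rw [fderiv_mollify_indicator hΩm (huv j) hUl (hφd i) (hφc i)
          (hφΩ i x ⟨hxi, subset_closure hx⟩)]
      · rw [image_eq_zero_of_notMem_tsupport hxi, zero_smul, zero_smul]
    -- Since the derivatives of the cutoffs sum to zero, `u` can be subtracted from each
    -- mollification in the product-rule terms. They are then controlled by the small errors `E i`.
    have hder0 : ∀ x ∈ Ω, ∑ i, fderiv ℝ (χ i) x (EuclideanSpace.single j (1 : ℝ)) = 0 := by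
      intro x hx
      have h1 : (fun y => ∑ i, χ i y) =ᶠ[𝓝 x] fun _ => (1 : ℝ) :=
        mem_of_superset (hΩ.mem_nhds hx) fun y hy => hχ1 y (subset_closure hy)
      have h2 := h1.fderiv_eq (𝕜 := ℝ)
      rw [fderiv_fun_sum fun i _ => (hχd i).differentiable (by simp) x] at h2
      have h3 := congrArg (fun L => L (EuclideanSpace.single j (1 : ℝ))) h2
      simpa using h3
    have hpt : ∀ x ∈ Ω, v j x - fderiv ℝ (fun x => ∑ i, χ i x • mollify (φ i) U x) x
        (EuclideanSpace.single j 1) = -∑ i, (χ i x • F i j x +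
          fderiv ℝ (χ i) x (EuclideanSpace.single j (1 : ℝ)) • E i x) := by
      intro x hx
      rw [hder x hx]
      have h1 := hχ1 x (subset_closure hx)
      simp only [hE, hF, smul_sub, Finset.sum_sub_distrib, Finset.sum_add_distrib,
        ← Finset.sum_smul, h1, one_smul, hder0 x hx, zero_smul, hW,
        indicator_of_mem hx]
      ring
    calc eLpNorm (fun x => v j x - fderiv ℝ (fun x => ∑ i, χ i x • mollify (φ i) U x) x
          (EuclideanSpace.single j 1)) (ENNReal.ofReal p) (volume.restrict Ω)
        ≤ eLpNorm (∑ i, ((fun x => ‖F i j x‖) + M • fun x => ‖E i x‖)) (ENNReal.ofReal p)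
            (volume.restrict Ω) := by
          refine eLpNorm_mono_ae ?_
          filter_upwards [ae_restrict_mem hΩm] with x hx
          rw [hpt x hx, norm_neg, Finset.sum_apply, Real.norm_of_nonneg
            (Finset.sum_nonneg fun i _ => by
              simp only [Pi.add_apply, Pi.smul_apply, smul_eq_mul]; positivity)]
          refine (norm_sum_le _ _).trans (Finset.sum_le_sum fun i _ => ?_)
          refine (norm_add_le _ _).trans ?_
          rw [norm_smul, norm_smul]
          exact add_le_add (mul_le_of_le_one_left (norm_nonneg _) (hχn i x))
            (mul_le_mul_of_nonneg_right (hM i j x (subset_closure hx)) (norm_nonneg _))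
      _ ≤ ∑ i, eLpNorm ((fun x => ‖F i j x‖) + M • fun x => ‖E i x‖) (ENNReal.ofReal p)
            (volume.restrict Ω) :=
          eLpNorm_sum_le (fun i _ => (hFm i j).norm.add ((hEm i).norm.const_smul M)) hP1
      _ ≤ ∑ i : T, ENNReal.ofReal (M * δ + δ) := Finset.sum_le_sum fun i _ => by
          refine (eLpNorm_add_le (hFm i j).norm ((hEm i).norm.const_smul M) hP1).trans ?_
          rw [eLpNorm_const_smul, eLpNorm_norm, eLpNorm_norm, add_comm (M * δ),
            ENNReal.ofReal_add hδ0.le (by positivity), ENNReal.ofReal_mul hM0,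
            Real.enorm_of_nonneg hM0]
          gcongr
          · exact hFn i j
          · exact hEn i
      _ ≤ ENNReal.ofReal ε := by simpa using hNδ

end Density

/-! ### Inward shifts of domains with graph boundary. -/

section Patch

variable {n : ℕ} {Ω : Set (Euc (n + 1))}

/-- The image of the last coordinate vector under the linear part of `e`. -/
noncomputable def lastDir (e : Euc (n + 1) ≃ᵃⁱ[ℝ] Euc (n + 1)) : Euc (n + 1) :=
  e.linearIsometryEquiv (joinLast 0 1)

theorem apply_joinLast_add (e : Euc (n + 1) ≃ᵃⁱ[ℝ] Euc (n + 1)) (x : Euc n) (s t : ℝ) :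
    e (joinLast x (s + t)) = e (joinLast x s) + t • lastDir e := by
  have h := e.map_vadd (joinLast x s) (t • joinLast 0 1)
  rw [vadd_eq_add, vadd_eq_add, map_smul] at h
  have h2 := joinLast_add_smul x 0 s 1 t
  rw [smul_zero, add_zero, mul_one] at h2
  rw [h2, add_comm (joinLast x s), h]
  exact add_comm _ _

theorem joinLast_injective {x y : Euc n} {s t : ℝ} (h : joinLast x s = joinLast y t) :
    x = y ∧ s = t := by
  constructor
  · ext j
    have := congrArg (fun z : Euc (n + 1) => z j.castSucc) h
    simpa [joinLast] using this
  · have := congrArg (fun z : Euc (n + 1) => z (Fin.last n)) h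
    simpa [joinLast] using this

/-- Moving up by `t > 0` takes a point on or above the graph strictly above it. Compactness of `K`
keeps the moved point in `V` for small `t`, and there only the points of `Ω` are neither on the
graph nor below it. -/
theorem IsGraphPatch.eventually_shift {a b : ℝ} {e : Euc (n + 1) ≃ᵃⁱ[ℝ] Euc (n + 1)}
    {f : Euc n → ℝ} {V : Set (Euc (n + 1))} (hV : IsGraphPatch Ω a b e f V) {K : Set (Euc (n + 1))}
    (hKV : K ⊆ V) (hK : IsCompact K) :
    ∀ᶠ t in 𝓝[>] (0 : ℝ), ∀ x ∈ K ∩ closure Ω, x + t • lastDir e ∈ Ω := by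
  obtain ⟨hVo, h1, h2, h3⟩ := hV
  obtain ⟨δ, hδ, hδV⟩ := hK.exists_cthickening_subset_open hVo hKV
  have hsmall : ∀ᶠ t in 𝓝[>] (0 : ℝ), ‖t • lastDir e‖ < δ := by
    have : Tendsto (fun t : ℝ => ‖t • lastDir e‖) (𝓝 0) (𝓝 0) := by
      have h : Continuous fun t : ℝ => ‖t • lastDir e‖ := by fun_prop
      simpa using h.tendsto 0
    exact (this.mono_left nhdsWithin_le_nhds).eventually_lt_const hδ
  filter_upwards [hsmall, self_mem_nhdsWithin] with t ht ht0 z hz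
  have ht0 : 0 < t := ht0
  have hzV : z + t • lastDir e ∈ V := hδV (Metric.mem_cthickening_of_dist_le _ z _ _ hz.1 (by
    rw [dist_eq_norm]; simpa using ht.le))
  obtain ⟨x, s, hx, hs, rfl⟩ : ∃ x s, x ∈ openCube n a ∧ f x ≤ s ∧ z = e (joinLast x s) := by
    by_cases hzΩ : z ∈ Ω
    · have : z ∈ V ∩ Ω := ⟨hKV hz.1, hzΩ⟩
      rw [h2] at this
      obtain ⟨x, hx, s, hs, -, rfl⟩ := this
      exact ⟨x, s, hx, hs.le, rfl⟩
    · have : z ∈ V ∩ frontier Ω := ⟨hKV hz.1, hz.2, fun h => hzΩ (interior_subset h)⟩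
      rw [h1] at this
      obtain ⟨x, hx, rfl⟩ := this
      exact ⟨x, f x, hx, le_rfl, rfl⟩
  rw [← apply_joinLast_add] at hzV ⊢
  -- Arguing by exclusion within `V` avoids comparing the new height with the top of the strip.
  by_contra hnot
  by_cases hcl : e (joinLast x (s + t)) ∈ closure Ω
  · have : e (joinLast x (s + t)) ∈ V ∩ frontier Ω :=
      ⟨hzV, hcl, fun h => hnot (interior_subset h)⟩
    rw [h1] at this
    obtain ⟨y, -, hy⟩ := this
    obtain ⟨rfl, h⟩ := joinLast_injective (e.injective hy)
    linarith
  · have : e (joinLast x (s + t)) ∈ V ∩ (closure Ω)ᶜ := ⟨hzV, hcl⟩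
    rw [h3] at this
    obtain ⟨y, -, r, -, hr, hy⟩ := this
    obtain ⟨rfl, h⟩ := joinLast_injective (e.injective hy)
    linarith

theorem GraphSystem.hasInwardShifts (A : GraphSystem Ω) (hΩ : IsOpen Ω) : HasInwardShifts Ω := by
  intro z hz
  by_cases hzΩ : z ∈ Ω
  · exact ⟨Ω, hΩ, hzΩ, 0, fun K hK _ => Eventually.of_forall fun t x hx => by
      simpa using hK hx.1⟩
  · obtain ⟨r, V, hzV, hV⟩ := A.cover z ⟨hz, fun h => hzΩ (interior_subset h)⟩
    exact ⟨V, hV.1, hzV, lastDir (A.coord r), fun K hK hKc => hV.eventually_shift hK hKc⟩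

end Patch

/-! ## The trace inequality for smooth functions -/

section SmoothTrace

/-- The derivative of `-(δ - t) g(t)` is `g(t) - (δ - t) g'(t)`, so `g 0` is the mean of the latter
over `(0, δ]`. Jensen's inequality, `|δ - t| ≤ δ` and `(a + b)^p ≤ 2^(p-1) (a^p + b^p)` finish the
estimate. The dependence on `δ` is kept explicit because `δ` is optimised later. -/
theorem enorm_rpow_le_lintegral {g g' : ℝ → ℂ} (hg : ∀ t, HasDerivAt g (g' t) t)
    (hg' : Continuous g') {p δ : ℝ} (hp : 1 ≤ p) (hδ : 0 < δ) :
    ‖g 0‖ₑ ^ p ≤ ∫⁻ t in Ioc 0 δ, (ENNReal.ofReal (2 ^ (p - 1) * δ⁻¹) * ‖g t‖ₑ ^ p +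
      ENNReal.ofReal (2 ^ (p - 1) * δ ^ (p - 1)) * ‖g' t‖ₑ ^ p) := by
  have hp0 : 0 < p := by linarith
  have hgc : Continuous g := continuous_iff_continuousAt.2 fun t => (hg t).continuousAt
  set m : Measure ℝ := (ENNReal.ofReal δ)⁻¹ • volume.restrict (Ioc 0 δ) with hm
  have hδ' : ENNReal.ofReal δ ≠ 0 := by simpa using hδ
  have : IsProbabilityMeasure m := ⟨by
    simp [hm, ENNReal.inv_mul_cancel hδ' ENNReal.ofReal_ne_top]⟩
  set h : ℝ → ℂ := fun t => g t - ((δ - t : ℝ) : ℂ) * g' t with hh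
  have hhc : Continuous h := by fun_prop
  have hder : ∀ t, HasDerivAt (fun t => -(((δ - t : ℝ) : ℂ) * g t)) (h t) t := by
    intro t
    have h1 : HasDerivAt (fun t : ℝ => ((δ - t : ℝ) : ℂ)) ((-1 : ℝ) : ℂ) t :=
      ((hasDerivAt_id t).const_sub δ).ofReal_comp
    refine (h1.mul (hg t)).neg.congr_deriv ?_
    simp only [hh]
    push_cast
    ring
  have hint : ∫ t in Ioc 0 δ, h t = δ * g 0 := by
    rw [← intervalIntegral.integral_of_le hδ.le,
      intervalIntegral.integral_eq_sub_of_hasDerivAt (fun t _ => hder t)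
        (hhc.intervalIntegrable _ _)]
    simp
  have hg0 : g 0 = ∫ t, h t ∂m := by
    rw [hm, integral_smul_measure, hint, ENNReal.toReal_inv, ENNReal.toReal_ofReal hδ.le,
      Complex.real_smul, ← mul_assoc, ← Complex.ofReal_mul, inv_mul_cancel₀ hδ.ne']
    simp
  rw [hg0]
  refine (enorm_integral_rpow_le hhc.aestronglyMeasurable hp).trans ?_
  rw [hm, lintegral_smul_measure, smul_eq_mul, ← lintegral_const_mul _ (by fun_prop)]
  refine setLIntegral_mono (by fun_prop) fun t ht => ?_
  have h1 : ‖h t‖ₑ ≤ ‖g t‖ₑ + ENNReal.ofReal δ * ‖g' t‖ₑ := by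
    refine (enorm_sub_le).trans ?_
    gcongr
    rw [enorm_mul, ← ofReal_norm]
    gcongr
    rw [Complex.norm_real, Real.norm_of_nonneg (by linarith [ht.2])]
    linarith [ht.1]
  calc (ENNReal.ofReal δ)⁻¹ * ‖h t‖ₑ ^ p
      ≤ (ENNReal.ofReal δ)⁻¹ * (2 ^ (p - 1) * (‖g t‖ₑ ^ p +
          (ENNReal.ofReal δ * ‖g' t‖ₑ) ^ p)) := by
        gcongr
        exact (ENNReal.rpow_le_rpow h1 hp0.le).trans
          (ENNReal.rpow_add_le_mul_rpow_add_rpow _ _ hp)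
    _ = _ := by
        have e2 : ENNReal.ofReal (2 ^ (p - 1)) = 2 ^ (p - 1) := by
          rw [← ENNReal.ofReal_rpow_of_pos (by norm_num)]; norm_num
        rw [ENNReal.mul_rpow_of_nonneg _ _ hp0.le, ENNReal.ofReal_mul (by positivity),
          ENNReal.ofReal_mul (by positivity), e2, ENNReal.ofReal_inv_of_pos hδ,
          ← ENNReal.ofReal_rpow_of_pos hδ, ENNReal.rpow_sub _ _ hδ' ENNReal.ofReal_ne_top,
          ENNReal.rpow_one, div_eq_mul_inv]
        ring

variable {n : ℕ} {Ω : Set (Euc (n + 1))}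

theorem measurableSet_openCube (m : ℕ) (a : ℝ) : MeasurableSet (openCube m a) := by
  rw [show openCube m a = ⋂ j, {y : Euc m | |y j| < a} by ext; simp [openCube]]
  exact MeasurableSet.iInter fun j =>
    (isOpen_lt (by fun_prop) continuous_const).measurableSet

theorem measurePreserving_joinLast :
    MeasurePreserving (fun z : ℝ × Euc n => joinLast z.2 z.1) := by
  have h1 : MeasurePreserving (Prod.map (id : ℝ → ℝ) (WithLp.ofLp : Euc n → (Fin n → ℝ))) :=
    (MeasurePreserving.id volume).prod (PiLp.volume_preserving_ofLp (Fin n))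
  have h2 := (volume_preserving_piFinSuccAbove (fun _ : Fin (n + 1) => ℝ) (Fin.last n)).symm
  have h3 := PiLp.volume_preserving_toLp (Fin (n + 1))
  convert h3.comp (h2.comp h1) using 1
  ext z j
  simp [joinLast, MeasurableEquiv.piFinSuccAbove, Fin.insertNthEquiv, Fin.insertNth_last']

theorem measurePreserving_affineIsometryEquiv {d : ℕ} (e : Euc d ≃ᵃⁱ[ℝ] Euc d) :
    MeasurePreserving e := by
  have h : (e : Euc d → Euc d) = (fun x => x + e 0) ∘ e.linearIsometryEquiv := by
    ext1 x
    have := e.map_vadd 0 x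
    simpa using this
  rw [h]
  exact (measurePreserving_add_right volume (e 0)).comp e.linearIsometryEquiv.measurePreserving

/-- For `0 < t ≤ δ < b` the points above the graph lie in `Ω`. For fixed `x` the shift by `f x` is
removed by translation invariance in the last variable, so no Jacobian and no measurability of `f`
enters. Extending `F` by zero outside `Ω` lets this variable run over the whole line. -/
theorem IsGraphPatch.lintegral_le {a b : ℝ} {e : Euc (n + 1) ≃ᵃⁱ[ℝ] Euc (n + 1)}
    {f : Euc n → ℝ} {V : Set (Euc (n + 1))} (hV : IsGraphPatch Ω a b e f V) (hΩ : IsOpen Ω)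
    {F : Euc (n + 1) → ℝ≥0∞} (hF : Measurable F) {δ : ℝ} (hδ : δ < b) :
    ∫⁻ x in openCube n a, ∫⁻ t in Ioc 0 δ, F (e (joinLast x (f x + t))) ≤ ∫⁻ z in Ω, F z := by
  set G := Ω.indicator F with hG
  have hGm : Measurable G := hF.indicator hΩ.measurableSet
  have hmp : MeasurePreserving (fun z : ℝ × Euc n => e (joinLast z.2 z.1)) :=
    (measurePreserving_affineIsometryEquiv e).comp measurePreserving_joinLast
  have hin : ∀ x ∈ openCube n a, ∫⁻ t in Ioc 0 δ, F (e (joinLast x (f x + t))) ≤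
      ∫⁻ s, G (e (joinLast x s)) := by
    intro x hx
    calc ∫⁻ t in Ioc 0 δ, F (e (joinLast x (f x + t)))
        = ∫⁻ t in Ioc 0 δ, G (e (joinLast x (f x + t))) := by
          refine setLIntegral_congr_fun measurableSet_Ioc fun t ht => ?_
          have : e (joinLast x (f x + t)) ∈ V ∩ Ω := by
            rw [hV.2.2.1]
            exact ⟨x, hx, f x + t, by linarith [ht.1], by linarith [ht.2], rfl⟩
          simp only [hG, indicator_of_mem this.2]
      _ ≤ ∫⁻ t, G (e (joinLast x (f x + t))) := setLIntegral_le_lintegral _ _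
      _ = ∫⁻ s, G (e (joinLast x s)) :=
          lintegral_add_left_eq_self (fun s => G (e (joinLast x s))) (f x)
  calc ∫⁻ x in openCube n a, ∫⁻ t in Ioc 0 δ, F (e (joinLast x (f x + t)))
      ≤ ∫⁻ x in openCube n a, ∫⁻ s, G (e (joinLast x s)) :=
        setLIntegral_mono' (measurableSet_openCube n a) hin
    _ ≤ ∫⁻ x : Euc n, ∫⁻ s, G (e (joinLast x s)) := setLIntegral_le_lintegral _ _
    _ = ∫⁻ z : ℝ × Euc n, G (e (joinLast z.2 z.1)) :=
        (lintegral_prod_symm' (μ := (volume : Measure ℝ)) (ν := (volume : Measure (Euc n)))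
          (fun z => G (e (joinLast z.2 z.1))) (hGm.comp hmp.measurable)).symm
    _ = ∫⁻ z, G z := hmp.lintegral_comp hGm
    _ = ∫⁻ z in Ω, F z := lintegral_indicator hΩ.measurableSet _

theorem norm_lastDir (e : Euc (n + 1) ≃ᵃⁱ[ℝ] Euc (n + 1)) : ‖lastDir e‖ = 1 := by
  rw [lastDir, LinearIsometryEquiv.norm_map, ← sq_eq_sq₀ (norm_nonneg _) zero_le_one,
    ← real_inner_self_eq_norm_sq, inner_joinLast]
  simp

theorem norm_apply_le_sum_single {d : ℕ} (L : Euc d →L[ℝ] ℂ) {v : Euc d} (hv : ‖v‖ = 1) :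
    ‖L v‖ ≤ ∑ j, ‖L (EuclideanSpace.single j 1)‖ := by
  have h : v = ∑ j, v j • EuclideanSpace.single j (1 : ℝ) := by
    ext i
    simp [Finset.sum_apply, Pi.single_apply]
  conv_lhs => rw [h]
  rw [map_sum]
  refine (norm_sum_le _ _).trans (Finset.sum_le_sum fun j _ => ?_)
  rw [map_smul, norm_smul]
  refine mul_le_of_le_one_left (norm_nonneg _) ?_
  rw [← hv]
  exact PiLp.norm_apply_le v j

theorem eLpNorm_ofReal_rpow {X : Type*} [MeasurableSpace X] {m : Measure X} (g : X → ℂ) {p : ℝ}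
    (hp : 0 < p) : eLpNorm g (ENNReal.ofReal p) m ^ p = ∫⁻ x, ‖g x‖ₑ ^ p ∂m := by
  rw [eLpNorm_eq_lintegral_rpow_enorm_toReal (by simpa using hp) (by simp),
    ENNReal.toReal_ofReal hp.le, ← ENNReal.rpow_mul]
  simp [hp.ne']

/-- The one-dimensional estimate is applied on each vertical segment, which has velocity `lastDir
e`, and integrated over the cube. -/
theorem IsGraphPatch.eLpNorm_rpow_le {a b : ℝ} {e : Euc (n + 1) ≃ᵃⁱ[ℝ] Euc (n + 1)}
    {f : Euc n → ℝ} {V : Set (Euc (n + 1))} (hV : IsGraphPatch Ω a b e f V) (hΩ : IsOpen Ω)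
    {w : Euc (n + 1) → ℂ} (hw : ContDiff ℝ ∞ w) {p δ : ℝ} (hp : 1 ≤ p) (hδ0 : 0 < δ)
    (hδ : δ < b) :
    eLpNorm (fun x => w (e (joinLast x (f x)))) (ENNReal.ofReal p)
        (volume.restrict (openCube n a)) ^ p ≤
      ENNReal.ofReal (2 ^ (p - 1) * δ⁻¹) *
          eLpNorm w (ENNReal.ofReal p) (volume.restrict Ω) ^ p +
        ENNReal.ofReal (2 ^ (p - 1) * δ ^ (p - 1)) *
          eLpNorm (fun z => fderiv ℝ w z (lastDir e)) (ENNReal.ofReal p)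
            (volume.restrict Ω) ^ p := by
  have hp0 : 0 < p := by linarith
  have hDc : Continuous fun z => fderiv ℝ w z (lastDir e) :=
    (hw.continuous_fderiv (by simp)).clm_apply continuous_const
  have hwc := hw.continuous
  rw [eLpNorm_ofReal_rpow _ hp0, eLpNorm_ofReal_rpow _ hp0, eLpNorm_ofReal_rpow _ hp0,
    ← lintegral_const_mul _ (by fun_prop), ← lintegral_const_mul _ (by fun_prop),
    ← lintegral_add_left (by fun_prop)]
  refine le_trans (lintegral_mono fun x => ?_)
    (hV.lintegral_le hΩ (F := fun z => ENNReal.ofReal (2 ^ (p - 1) * δ⁻¹) * ‖w z‖ₑ ^ p +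
      ENNReal.ofReal (2 ^ (p - 1) * δ ^ (p - 1)) * ‖fderiv ℝ w z (lastDir e)‖ₑ ^ p)
      (by fun_prop) hδ)
  have hline : ∀ t : ℝ, HasDerivAt (fun t : ℝ => e (joinLast x (f x + t))) (lastDir e) t := by
    intro t
    simp_rw [apply_joinLast_add]
    simpa using ((hasDerivAt_id t).smul_const (lastDir e)).const_add (e (joinLast x (f x)))
  have hlc : Continuous (fun t : ℝ => e (joinLast x (f x + t))) :=
    continuous_iff_continuousAt.2 fun t => (hline t).continuousAt
  have := enorm_rpow_le_lintegral (g := fun t => w (e (joinLast x (f x + t))))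
    (g' := fun t => fderiv ℝ w (e (joinLast x (f x + t))) (lastDir e))
    (fun t => ((hw.differentiable (by simp)) _).hasFDerivAt.comp_hasDerivAt t (hline t))
    (hDc.comp hlc) hp hδ0
  simpa only [add_zero] using this

/-- The multiplicative trace inequality for smooth functions. -/
theorem GraphSystem.exists_eLpNorm_bdryPt_le (A : GraphSystem Ω) (hΩ : IsOpen Ω) {p : ℝ}
    (hp : 1 ≤ p) : ∃ K : ℝ, 0 < K ∧ ∀ (w : Euc (n + 1) → ℂ), ContDiff ℝ ∞ w →
      ∀ (r : Fin A.m) (X Y : ℝ), 0 < X → X ≤ Y →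
      eLpNorm w (ENNReal.ofReal p) (volume.restrict Ω) ≤ ENNReal.ofReal X →
      ∑ j, eLpNorm (fun x => fderiv ℝ w x (EuclideanSpace.single j 1)) (ENNReal.ofReal p)
        (volume.restrict Ω) ≤ ENNReal.ofReal Y →
      eLpNorm (fun x => w (A.bdryPt r x)) (ENNReal.ofReal p)
        (volume.restrict (openCube n A.a)) ≤
          ENNReal.ofReal (K * X ^ ((p - 1) / p) * Y ^ (1 / p)) := by
  have hp0 : 0 < p := by linarith
  have hb := A.b_pos
  set c := A.b / 2 with hc
  have hc0 : 0 < c := by positivity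
  set K := 2 ^ (p - 1) * (c⁻¹ + c ^ (p - 1)) with hK
  have hK0 : 0 < K := by positivity
  refine ⟨K ^ (1 / p), by positivity, fun w hw r X Y hX hXY hwX hwY => ?_⟩
  have hY : 0 < Y := hX.trans_le hXY
  obtain ⟨V, hV⟩ := A.patch r
  -- This choice makes both `δ⁻¹ * X ^ p` and `δ ^ (p - 1) * Y ^ p` multiples of `X ^ (p - 1) * Y`.
  -- The condition `X ≤ Y` gives `δ ≤ c < b`, and `0 < X` gives `0 < δ`.
  set δ := c * (X / Y) with hδ
  have hδ0 : 0 < δ := by positivity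
  have hδb : δ < A.b := by
    have : X / Y ≤ 1 := (div_le_one hY).2 hXY
    nlinarith
  have hD : eLpNorm (fun z => fderiv ℝ w z (lastDir (A.coord r))) (ENNReal.ofReal p)
      (volume.restrict Ω) ≤ ENNReal.ofReal Y := by
    have hm : ∀ j, AEStronglyMeasurable
        (fun x => fderiv ℝ w x (EuclideanSpace.single j (1 : ℝ))) (volume.restrict Ω) := fun j =>
      ((hw.continuous_fderiv (by simp)).clm_apply continuous_const).aestronglyMeasurable
    refine le_trans ?_ ((eLpNorm_sum_le (s := Finset.univ) (fun j _ => (hm j).norm)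
      (ENNReal.one_le_ofReal.2 hp)).trans
      (le_trans (le_of_eq ?_) hwY))
    · refine eLpNorm_mono fun x => ?_
      rw [Finset.sum_apply, Real.norm_of_nonneg (Finset.sum_nonneg fun _ _ => norm_nonneg _)]
      exact norm_apply_le_sum_single _ (norm_lastDir _)
    · exact Finset.sum_congr rfl fun j _ => eLpNorm_norm _
  have hmain := hV.eLpNorm_rpow_le hΩ hw hp hδ0 hδb
  rw [← ENNReal.rpow_le_rpow_iff hp0]
  refine hmain.trans ?_
  calc _ ≤ ENNReal.ofReal (2 ^ (p - 1) * δ⁻¹) * ENNReal.ofReal X ^ p +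
        ENNReal.ofReal (2 ^ (p - 1) * δ ^ (p - 1)) * ENNReal.ofReal Y ^ p := by gcongr
    _ = ENNReal.ofReal (2 ^ (p - 1) * δ⁻¹ * X ^ p + 2 ^ (p - 1) * δ ^ (p - 1) * Y ^ p) := by
        rw [ENNReal.ofReal_add (by positivity) (by positivity),
          ENNReal.ofReal_mul (p := 2 ^ (p - 1) * δ⁻¹) (by positivity),
          ENNReal.ofReal_mul (p := 2 ^ (p - 1) * δ ^ (p - 1)) (by positivity),
          ENNReal.ofReal_rpow_of_pos hX, ENNReal.ofReal_rpow_of_pos hY]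
    _ = _ := by
        rw [ENNReal.ofReal_rpow_of_pos (by positivity)]
        have hR : (K ^ (1 / p) * X ^ ((p - 1) / p) * Y ^ (1 / p)) ^ p = K * X ^ (p - 1) * Y := by
          rw [Real.mul_rpow (by positivity) (by positivity),
            Real.mul_rpow (by positivity) (by positivity), ← Real.rpow_mul hK0.le,
            ← Real.rpow_mul hX.le, ← Real.rpow_mul hY.le, div_mul_cancel₀ _ hp0.ne',
            div_mul_cancel₀ _ hp0.ne', Real.rpow_one, Real.rpow_one]
        rw [hR, hK, hδ, Real.mul_rpow hc0.le (by positivity), Real.div_rpow hX.le hY.le,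
          Real.rpow_sub_one hX.ne', Real.rpow_sub_one hY.ne']
        have := Real.rpow_pos_of_pos hX p
        have := Real.rpow_pos_of_pos hY p
        field_simp
        try ring

end SmoothTrace

/-! ## Equivalent norms -/

section Norms

variable {d : ℕ} {Ω : Set (Euc d)} {p : ℝ} {k : ℕ} {u v : Euc d → ℂ}

theorem lpNorm_ofReal_rpow {X : Type*} [MeasurableSpace X] {m : Measure X} {g : X → ℂ}
    (hp : 0 < p) (hg : AEStronglyMeasurable g m) :
    lpNorm g (ENNReal.ofReal p) m ^ p = ∫ x, ‖g x‖ ^ p ∂m := by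
  rw [lpNorm_eq_integral_norm_rpow_toReal (by simpa using hp) (by simp) hg,
    ENNReal.toReal_ofReal hp.le,
    Real.rpow_inv_rpow (integral_nonneg fun x => by positivity) hp.ne']

theorem lpNorm_congr_ae {X : Type*} [MeasurableSpace X] {m : Measure X} {f g : X → ℂ}
    {P : ℝ≥0∞} (h : f =ᵐ[m] g) : lpNorm f P m = lpNorm g P m := by
  by_cases hf : AEStronglyMeasurable f m
  · rw [← toReal_eLpNorm hf, ← toReal_eLpNorm (hf.congr h), eLpNorm_congr_ae h]
  -- By convention `lpNorm` is zero for functions that are not a.e. strongly measurable.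
  · rw [lpNorm_of_not_aestronglyMeasurable hf,
      lpNorm_of_not_aestronglyMeasurable fun hg => hf (hg.congr h.symm)]

theorem eq_zero_or_single_of_sum_le_one {α : Fin d → ℕ} (h : ∑ j, α j ≤ 1) :
    α = 0 ∨ ∃ j, α = Pi.single j 1 := by
  by_cases h0 : ∀ j, α j = 0
  · exact Or.inl (funext h0)
  push Not at h0
  obtain ⟨j, hj⟩ := h0
  refine Or.inr ⟨j, funext fun i => ?_⟩
  have hs := Finset.add_sum_erase Finset.univ α (Finset.mem_univ j)
  by_cases hij : i = j
  · subst hij; rw [Pi.single_eq_same]; omega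
  · rw [Pi.single_eq_of_ne hij]
    have := Finset.single_le_sum (f := α) (fun _ _ => Nat.zero_le _)
      (Finset.mem_erase.2 ⟨hij, Finset.mem_univ i⟩)
    omega

namespace MemSobolev

theorem hasWeakD_weakD (h : MemSobolev k p Ω u) {α : Fin d → ℕ} (hα : ∑ j, α j ≤ k) :
    HasWeakD Ω α u (weakD Ω α u) :=
  let ⟨_, hv, _⟩ := h.2 α hα
  hv.weakD

theorem memLp_weakD (h : MemSobolev k p Ω u) (hΩ : IsOpen Ω) {α : Fin d → ℕ}
    (hα : ∑ j, α j ≤ k) : MemLp (weakD Ω α u) (ENNReal.ofReal p) (volume.restrict Ω) := by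
  obtain ⟨v, hv, hvp⟩ := h.2 α hα
  exact hvp.ae_eq (hv.weakD_ae_eq hΩ).symm

theorem mono {l : ℕ} (h : MemSobolev k p Ω u) (hl : l ≤ k) : MemSobolev l p Ω u :=
  ⟨h.1, fun α hα => h.2 α (hα.trans hl)⟩

theorem add (h : MemSobolev k p Ω u) (h' : MemSobolev k p Ω v) : MemSobolev k p Ω (u + v) := by
  refine ⟨h.1.add h'.1, fun α hα => ?_⟩
  obtain ⟨v, hv, hvp⟩ := h.2 α hα
  obtain ⟨w, hw, hwp⟩ := h'.2 α hα
  exact ⟨v + w, hv.add hw, hvp.add hwp⟩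

theorem const_smul (h : MemSobolev k p Ω u) (c : ℂ) : MemSobolev k p Ω (c • u) := by
  refine ⟨h.1.const_smul c, fun α hα => ?_⟩
  obtain ⟨v, hv, hvp⟩ := h.2 α hα
  exact ⟨c • v, hv.const_smul c, hvp.const_smul c⟩

theorem weakD_single (h : MemSobolev (k + 1) p Ω u) (hΩ : IsOpen Ω) (j : Fin d) :
    MemSobolev k p Ω (weakD Ω (Pi.single j 1) u) := by
  have hj : ∑ i, (Pi.single j 1 : Fin d → ℕ) i ≤ k + 1 := by simp
  refine ⟨h.memLp_weakD hΩ hj, fun α hα => ?_⟩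
  have hαj : ∑ i, (α + Pi.single j 1 : Fin d → ℕ) i ≤ k + 1 := by
    simpa [Finset.sum_add_distrib] using hα
  exact ⟨_, (h.hasWeakD_weakD hj).of_add_single (h.hasWeakD_weakD hαj), h.memLp_weakD hΩ hαj⟩

theorem weakD_weakD_ae_eq (h : MemSobolev (k + 1) p Ω u) (hΩ : IsOpen Ω) (j : Fin d)
    {α : Fin d → ℕ} (hα : ∑ i, α i ≤ k) :
    weakD Ω α (weakD Ω (Pi.single j 1) u) =ᵐ[volume.restrict Ω]
      weakD Ω (α + Pi.single j 1) u := by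
  have hj : ∑ i, (Pi.single j 1 : Fin d → ℕ) i ≤ k + 1 := by simp
  have hαj : ∑ i, (α + Pi.single j 1 : Fin d → ℕ) i ≤ k + 1 := by
    simpa [Finset.sum_add_distrib] using hα
  exact ((h.hasWeakD_weakD hj).of_add_single (h.hasWeakD_weakD hαj)).weakD_ae_eq hΩ

theorem weakD_zero_ae_eq (h : MemSobolev k p Ω u) (hΩ : IsOpen Ω) :
    weakD Ω 0 u =ᵐ[volume.restrict Ω] u :=
  (hasWeakD_zero (h.hasWeakD_weakD (α := 0) (by simp)).1).weakD_ae_eq hΩ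

theorem sobolevNorm_eq (h : MemSobolev k p Ω u) (hΩ : IsOpen Ω) (hp : 0 < p) :
    sobolevNorm k p Ω u = (∑ l ∈ Finset.range (k + 1),
      ∑ α ∈ Finset.piAntidiag (Finset.univ : Finset (Fin d)) l,
        lpNorm (weakD Ω α u) (ENNReal.ofReal p) (volume.restrict Ω) ^ p) ^ (1 / p) := by
  rw [sobolevNorm]
  congr 1
  refine Finset.sum_congr rfl fun l hl => Finset.sum_congr rfl fun α hα => ?_
  rw [Finset.mem_piAntidiag] at hα
  rw [Finset.mem_range] at hl
  rw [lpNorm_ofReal_rpow hp (h.memLp_weakD hΩ (hα.1.le.trans (by omega))).aestronglyMeasurable]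

theorem lpNorm_weakD_le (h : MemSobolev k p Ω u) (hΩ : IsOpen Ω) (hp : 0 < p)
    {α : Fin d → ℕ} (hα : ∑ i, α i ≤ k) :
    lpNorm (weakD Ω α u) (ENNReal.ofReal p) (volume.restrict Ω) ≤ sobolevNorm k p Ω u := by
  rw [h.sobolevNorm_eq hΩ hp]
  have hn : ∀ β : Fin d → ℕ,
      0 ≤ lpNorm (weakD Ω β u) (ENNReal.ofReal p) (volume.restrict Ω) ^ p :=
    fun β => Real.rpow_nonneg lpNorm_nonneg _
  rw [one_div, Real.le_rpow_inv_iff_of_pos lpNorm_nonneg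
    (Finset.sum_nonneg fun _ _ => Finset.sum_nonneg fun _ _ => hn _) hp]
  have h1 := Finset.single_le_sum (f := fun β : Fin d → ℕ =>
    lpNorm (weakD Ω β u) (ENNReal.ofReal p) (volume.restrict Ω) ^ p)
    (s := Finset.piAntidiag Finset.univ (∑ i, α i)) (fun β _ => hn β) (a := α)
    (by simp [Finset.mem_piAntidiag])
  refine h1.trans (Finset.single_le_sum (f := fun l =>
    ∑ β ∈ Finset.piAntidiag (Finset.univ : Finset (Fin d)) l,
      lpNorm (weakD Ω β u) (ENNReal.ofReal p) (volume.restrict Ω) ^ p)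
    (fun l _ => Finset.sum_nonneg fun _ _ => hn _) ?_)
  simpa [Nat.lt_succ_iff] using hα

theorem lpNorm_le (h : MemSobolev k p Ω u) (hΩ : IsOpen Ω) (hp : 0 < p) :
    lpNorm u (ENNReal.ofReal p) (volume.restrict Ω) ≤ sobolevNorm k p Ω u := by
  rw [← lpNorm_congr_ae (h.weakD_zero_ae_eq hΩ)]
  exact h.lpNorm_weakD_le hΩ hp (by simp)

/-- With one bound for all derivatives, the sum of `p`-th powers is at most the number of
multi-indices of order at most `k` times `S ^ p`. -/
theorem sobolevNorm_le_mul (h : MemSobolev k p Ω u) (hΩ : IsOpen Ω) (hp : 0 < p) {S : ℝ}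
    (hS : ∀ α : Fin d → ℕ, ∑ i, α i ≤ k →
      lpNorm (weakD Ω α u) (ENNReal.ofReal p) (volume.restrict Ω) ≤ S) :
    sobolevNorm k p Ω u ≤ (∑ l ∈ Finset.range (k + 1),
      ((Finset.piAntidiag (Finset.univ : Finset (Fin d)) l).card : ℝ)) ^ (1 / p) * S := by
  have hS0 : 0 ≤ S := lpNorm_nonneg.trans (hS 0 (by simp))
  rw [h.sobolevNorm_eq hΩ hp]
  have hS' : (S ^ p) ^ (1 / p) = S := by
    rw [one_div, Real.rpow_rpow_inv hS0 hp.ne']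
  conv_rhs => rw [← hS']
  rw [← Real.mul_rpow (by positivity) (by positivity), Finset.sum_mul]
  refine Real.rpow_le_rpow (Finset.sum_nonneg fun _ _ => Finset.sum_nonneg fun _ _ =>
    Real.rpow_nonneg lpNorm_nonneg _) (Finset.sum_le_sum fun l hl => ?_) (by positivity)
  rw [← nsmul_eq_mul]
  refine Finset.sum_le_card_nsmul _ _ _ fun α hα => ?_
  rw [Finset.mem_piAntidiag] at hα
  rw [Finset.mem_range] at hl
  exact Real.rpow_le_rpow lpNorm_nonneg (hS α (hα.1.le.trans (by omega))) hp.le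

end MemSobolev

theorem sobolevNorm_nonneg : 0 ≤ sobolevNorm k p Ω u :=
  Real.rpow_nonneg (Finset.sum_nonneg fun _ _ => Finset.sum_nonneg fun _ _ =>
    integral_nonneg fun _ => Real.rpow_nonneg (norm_nonneg _) _) _

/-- The sum of the `L^p` norms of `u` and its first order derivatives. -/
noncomputable def sobolevSum (p : ℝ) (Ω : Set (Euc d)) (u : Euc d → ℂ) : ℝ :=
  lpNorm u (ENNReal.ofReal p) (volume.restrict Ω) +
    ∑ j, lpNorm (weakD Ω (Pi.single j 1) u) (ENNReal.ofReal p) (volume.restrict Ω)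

theorem lpNorm_le_sobolevSum :
    lpNorm u (ENNReal.ofReal p) (volume.restrict Ω) ≤ sobolevSum p Ω u :=
  le_add_of_nonneg_right (Finset.sum_nonneg fun _ _ => lpNorm_nonneg)

theorem sobolevSum_nonneg : 0 ≤ sobolevSum p Ω u := lpNorm_nonneg.trans lpNorm_le_sobolevSum

theorem MemSobolev.sobolevSum_le (h : MemSobolev 1 p Ω u) (hΩ : IsOpen Ω) (hp : 0 < p) :
    sobolevSum p Ω u ≤ (1 + d) * sobolevNorm 1 p Ω u := by
  have : ∑ j : Fin d, lpNorm (weakD Ω (Pi.single j 1) u) (ENNReal.ofReal p) (volume.restrict Ω)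
      ≤ ∑ _j : Fin d, sobolevNorm 1 p Ω u :=
    Finset.sum_le_sum fun j _ => h.lpNorm_weakD_le hΩ hp (by simp)
  simp only [Finset.sum_const, Finset.card_univ, Fintype.card_fin, nsmul_eq_mul] at this
  rw [sobolevSum, add_mul, one_mul]
  exact add_le_add (h.lpNorm_le hΩ hp) this

theorem exists_sobolevNorm_le_sobolevSum (hΩ : IsOpen Ω) (hp : 0 < p) :
    ∃ C : ℝ, 0 ≤ C ∧ ∀ u, MemSobolev 1 p Ω u → sobolevNorm 1 p Ω u ≤ C * sobolevSum p Ω u := by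
  -- The constant is left to unification: it is the number of multi-indices of order at most one, to
  -- the power `1 / p`.
  refine ⟨_, by positivity, fun u h => h.sobolevNorm_le_mul hΩ hp fun α hα => ?_⟩
  obtain rfl | ⟨j, rfl⟩ := eq_zero_or_single_of_sum_le_one hα
  · rw [lpNorm_congr_ae (h.weakD_zero_ae_eq hΩ)]
    exact lpNorm_le_sobolevSum
  · exact (Finset.single_le_sum (f := fun j : Fin d =>
      lpNorm (weakD Ω (Pi.single j 1) u) (ENNReal.ofReal p) (volume.restrict Ω))
      (fun _ _ => lpNorm_nonneg) (Finset.mem_univ j)).trans (le_add_of_nonneg_left lpNorm_nonneg)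

theorem exists_sobolevNorm_weakD_le (hΩ : IsOpen Ω) (hp : 0 < p) :
    ∃ C : ℝ, 0 ≤ C ∧ ∀ u, MemSobolev 2 p Ω u → ∀ j : Fin d,
      sobolevNorm 1 p Ω (weakD Ω (Pi.single j 1) u) ≤ C * sobolevNorm 2 p Ω u := by
  refine ⟨_, by positivity, fun u h j =>
    (h.weakD_single hΩ j).sobolevNorm_le_mul hΩ hp fun α hα => ?_⟩
  rw [lpNorm_congr_ae (h.weakD_weakD_ae_eq hΩ j hα)]
  exact h.lpNorm_weakD_le hΩ hp (by simpa [Finset.sum_add_distrib] using hα)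

theorem MemSobolev.weakD_add_ae_eq {α : Fin d → ℕ} (h : MemSobolev k p Ω u)
    (h' : MemSobolev k p Ω v) (hΩ : IsOpen Ω) (hα : ∑ i, α i ≤ k) :
    weakD Ω α (u + v) =ᵐ[volume.restrict Ω] weakD Ω α u + weakD Ω α v :=
  ((h.hasWeakD_weakD hα).add (h'.hasWeakD_weakD hα)).weakD_ae_eq hΩ

theorem MemSobolev.weakD_const_smul_ae_eq {α : Fin d → ℕ} (h : MemSobolev k p Ω u) (c : ℂ)
    (hΩ : IsOpen Ω) (hα : ∑ i, α i ≤ k) :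
    weakD Ω α (c • u) =ᵐ[volume.restrict Ω] c • weakD Ω α u :=
  ((h.hasWeakD_weakD hα).const_smul c).weakD_ae_eq hΩ

theorem sobolevSum_add_le (hΩ : IsOpen Ω) (hp : 1 ≤ p) (h : MemSobolev 1 p Ω u)
    (h' : MemSobolev 1 p Ω v) : sobolevSum p Ω (u + v) ≤ sobolevSum p Ω u + sobolevSum p Ω v := by
  have hP := ENNReal.one_le_ofReal.2 hp
  have h1 := lpNorm_add_le (g := v) h.1 hP
  have h2 : ∑ j, lpNorm (weakD Ω (Pi.single j 1) (u + v)) (ENNReal.ofReal p) (volume.restrict Ω)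
      ≤ ∑ j, (lpNorm (weakD Ω (Pi.single j 1) u) (ENNReal.ofReal p) (volume.restrict Ω) +
        lpNorm (weakD Ω (Pi.single j 1) v) (ENNReal.ofReal p) (volume.restrict Ω)) := by
    refine Finset.sum_le_sum fun j _ => ?_
    rw [lpNorm_congr_ae (h.weakD_add_ae_eq h' hΩ (by simp))]
    exact lpNorm_add_le (h.memLp_weakD hΩ (by simp)) hP
  rw [Finset.sum_add_distrib] at h2
  simp only [sobolevSum]
  linarith

theorem sobolevSum_const_smul (hΩ : IsOpen Ω) (h : MemSobolev 1 p Ω u) (c : ℂ) :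
    sobolevSum p Ω (c • u) = ‖c‖ * sobolevSum p Ω u := by
  simp only [sobolevSum, mul_add, Finset.mul_sum]
  rw [lpNorm_const_smul]
  congr 1
  refine Finset.sum_congr rfl fun j _ => ?_
  rw [lpNorm_congr_ae (h.weakD_const_smul_ae_eq c hΩ (by simp)), lpNorm_const_smul]
  rfl

theorem MemSobolev.sub (h : MemSobolev k p Ω u) (h' : MemSobolev k p Ω v) :
    MemSobolev k p Ω (u - v) := by
  simpa [sub_eq_add_neg] using h.add (h'.const_smul (-1))

theorem sobolevSum_sub_comm (hΩ : IsOpen Ω) (h : MemSobolev 1 p Ω u) (h' : MemSobolev 1 p Ω v) :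
    sobolevSum p Ω (u - v) = sobolevSum p Ω (v - u) := by
  have := sobolevSum_const_smul hΩ (h.sub h') (-1)
  simpa using this.symm

/-- Continuous functions are in `L^p` on bounded sets. -/
theorem Continuous.memLp_restrict (hb : Bornology.IsBounded Ω) {P : ℝ≥0∞} (hu : Continuous u) :
    MemLp u P (volume.restrict Ω) := by
  have hc := hb.isCompact_closure
  have : IsFiniteMeasure (volume.restrict (closure Ω)) := ⟨by
    simpa using hc.measure_lt_top⟩
  obtain ⟨C, hC⟩ := hc.exists_bound_of_continuousOn hu.continuousOn
  refine MemLp.mono_measure (Measure.restrict_mono subset_closure le_rfl)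
    (MemLp.of_bound hu.aestronglyMeasurable C ?_)
  filter_upwards [ae_restrict_mem isClosed_closure.measurableSet] with x hx using hC x hx

theorem ContDiff.memSobolev_one (hb : Bornology.IsBounded Ω) (hu : ContDiff ℝ ∞ u) :
    MemSobolev 1 p Ω u := by
  refine ⟨hu.continuous.memLp_restrict hb, fun α hα => ?_⟩
  obtain rfl | ⟨j, rfl⟩ := eq_zero_or_single_of_sum_le_one hα
  · exact ⟨u, hasWeakD_zero (hu.continuous.locallyIntegrable.locallyIntegrableOn _),
      hu.continuous.memLp_restrict hb⟩
  · exact ⟨_, hu.hasWeakD_single j, Continuous.memLp_restrict hb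
      ((hu.continuous_fderiv (by simp)).clm_apply continuous_const)⟩

/-- Density of smooth functions, for `sobolevSum`. -/
theorem MemSobolev.exists_sobolevSum_sub_le (hΩ : IsOpen Ω) (hb : Bornology.IsBounded Ω)
    (hs : HasInwardShifts Ω) (hp : 1 ≤ p) (h : MemSobolev 1 p Ω u) {ε : ℝ} (hε : 0 < ε) :
    ∃ w, ContDiff ℝ ∞ w ∧ sobolevSum p Ω (u - w) ≤ ε := by
  have hj : ∀ j, ∑ i, (Pi.single j 1 : Fin d → ℕ) i ≤ 1 := fun j => by simp
  obtain ⟨w, hw, h0, h1⟩ := exists_smooth_approx hΩ hb hs hp h.1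
    (fun j => h.hasWeakD_weakD (hj j)) (fun j => h.memLp_weakD hΩ (hj j))
    -- `sobolevSum` has `1 + d` terms.
    (ε := ε / (1 + d)) (by positivity)
  refine ⟨w, hw, ?_⟩
  have hwS : MemSobolev 1 p Ω w := hw.memSobolev_one hb
  have hε' : 0 ≤ ε / (1 + d) := by positivity
  have key : ∀ {f : Euc d → ℂ}, AEStronglyMeasurable f (volume.restrict Ω) →
      eLpNorm f (ENNReal.ofReal p) (volume.restrict Ω) ≤ ENNReal.ofReal (ε / (1 + d)) →
      lpNorm f (ENNReal.ofReal p) (volume.restrict Ω) ≤ ε / (1 + d) := fun hf hle => by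
    rw [← toReal_eLpNorm hf]
    exact ENNReal.toReal_le_of_le_ofReal hε' hle
  have e0 := key (h.1.sub hwS.1).aestronglyMeasurable h0
  have e1 : ∀ j, lpNorm (weakD Ω (Pi.single j 1) (u - w)) (ENNReal.ofReal p)
      (volume.restrict Ω) ≤ ε / (1 + d) := by
    intro j
    have hd : HasWeakD Ω (Pi.single j 1) (u - w) (weakD Ω (Pi.single j 1) u -
        fun x => fderiv ℝ w x (EuclideanSpace.single j 1)) := by
      have := (h.hasWeakD_weakD (hj j)).add ((hw.hasWeakD_single (Ω := Ω) j).const_smul (-1))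
      simpa [sub_eq_add_neg] using this
    rw [lpNorm_congr_ae (hd.weakD_ae_eq hΩ)]
    refine key ?_ (h1 j)
    exact (h.memLp_weakD hΩ (hj j)).aestronglyMeasurable.sub
      ((hw.continuous_fderiv (by simp)).clm_apply continuous_const).aestronglyMeasurable
  calc sobolevSum p Ω (u - w) ≤ ε / (1 + d) + ∑ _j : Fin d, ε / (1 + d) :=
        add_le_add e0 (Finset.sum_le_sum fun j _ => e1 j)
    _ = ε := by
        simp only [Finset.sum_const, Finset.card_univ, Fintype.card_fin, nsmul_eq_mul]
        field_simp

end Norms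

/-! ## Traces as limits of smooth functions -/

namespace GraphSystem

variable {n : ℕ} {Ω : Set (Euc (n + 1))} {A : GraphSystem Ω} {p : ℝ}
  {f g : Euc (n + 1) → ℂ} {u v : Euc (n + 1) → ℂ}

/-- The sum of the `L^p` norms of `f` in the charts. -/
noncomputable def bdrySum (A : GraphSystem Ω) (p : ℝ) (f : Euc (n + 1) → ℂ) : ℝ :=
  ∑ r, lpNorm (fun x => f (A.bdryPt r x)) (ENNReal.ofReal p) (volume.restrict (openCube n A.a))

theorem bdrySum_nonneg : 0 ≤ A.bdrySum p f := Finset.sum_nonneg fun _ _ => lpNorm_nonneg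

theorem MemLpBdry.bdryNorm_eq (hf : A.MemLpBdry p f) (hp : 0 < p) :
    A.bdryNorm p f = (∑ r, lpNorm (fun x => f (A.bdryPt r x)) (ENNReal.ofReal p)
      (volume.restrict (openCube n A.a)) ^ p) ^ (1 / p) := by
  rw [bdryNorm]
  congr 1
  exact Finset.sum_congr rfl fun r _ => (lpNorm_ofReal_rpow hp (hf r).aestronglyMeasurable).symm

theorem MemLpBdry.bdrySum_le (hf : A.MemLpBdry p f) (hp : 0 < p) :
    A.bdrySum p f ≤ A.m * A.bdryNorm p f := by
  have : ∀ r ∈ Finset.univ, lpNorm (fun x => f (A.bdryPt r x)) (ENNReal.ofReal p)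
      (volume.restrict (openCube n A.a)) ≤ A.bdryNorm p f := by
    intro r hr
    rw [hf.bdryNorm_eq hp, one_div, Real.le_rpow_inv_iff_of_pos lpNorm_nonneg
      (Finset.sum_nonneg fun _ _ => Real.rpow_nonneg lpNorm_nonneg _) hp]
    exact Finset.single_le_sum (f := fun r => lpNorm (fun x => f (A.bdryPt r x))
      (ENNReal.ofReal p) (volume.restrict (openCube n A.a)) ^ p)
      (fun _ _ => Real.rpow_nonneg lpNorm_nonneg _) hr
  simpa [bdrySum] using Finset.sum_le_card_nsmul _ _ _ this

theorem MemLpBdry.bdryNorm_le (hf : A.MemLpBdry p f) (hp : 0 < p) :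
    A.bdryNorm p f ≤ (A.m : ℝ) ^ (1 / p) * A.bdrySum p f := by
  have hS : (A.bdrySum p f ^ p) ^ (1 / p) = A.bdrySum p f := by
    rw [one_div, Real.rpow_rpow_inv bdrySum_nonneg hp.ne']
  have h0 : 0 ≤ A.bdrySum p f ^ p := Real.rpow_nonneg bdrySum_nonneg _
  rw [hf.bdryNorm_eq hp, ← hS, ← Real.mul_rpow (by positivity) h0]
  refine Real.rpow_le_rpow (Finset.sum_nonneg fun _ _ => Real.rpow_nonneg lpNorm_nonneg _) ?_
    (by positivity)
  rw [← nsmul_eq_mul]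
  refine (Finset.sum_le_card_nsmul _ _ (A.bdrySum p f ^ p) fun r hr => ?_).trans (by simp)
  exact Real.rpow_le_rpow lpNorm_nonneg (Finset.single_le_sum (f := fun r =>
    lpNorm (fun x => f (A.bdryPt r x)) (ENNReal.ofReal p) (volume.restrict (openCube n A.a)))
    (fun _ _ => lpNorm_nonneg) hr) hp.le

theorem bdrySum_congr (h : A.BdryAEEq f g) : A.bdrySum p f = A.bdrySum p g :=
  Finset.sum_congr rfl fun r _ => lpNorm_congr_ae (h r)

theorem MemLpBdry.add (hf : A.MemLpBdry p f) (hg : A.MemLpBdry p g) : A.MemLpBdry p (f + g) :=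
  fun r => (hf r).add (hg r)

theorem MemLpBdry.sub (hf : A.MemLpBdry p f) (hg : A.MemLpBdry p g) : A.MemLpBdry p (f - g) :=
  fun r => (hf r).sub (hg r)

theorem MemLpBdry.const_smul (hf : A.MemLpBdry p f) (c : ℂ) : A.MemLpBdry p (c • f) :=
  fun r => (hf r).const_smul c

theorem MemLpBdry.bdrySum_add_le (hf : A.MemLpBdry p f) (hp : 1 ≤ p) :
    A.bdrySum p (f + g) ≤ A.bdrySum p f + A.bdrySum p g := by
  rw [bdrySum, bdrySum, bdrySum, ← Finset.sum_add_distrib]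
  exact Finset.sum_le_sum fun r _ => lpNorm_add_le (hf r) (ENNReal.one_le_ofReal.2 hp)

theorem bdrySum_const_smul (c : ℂ) : A.bdrySum p (c • f) = ‖c‖ * A.bdrySum p f := by
  rw [bdrySum, bdrySum, Finset.mul_sum]
  refine Finset.sum_congr rfl fun r _ => ?_
  exact lpNorm_const_smul c (fun x => f (A.bdryPt r x)) _

theorem MemLpBdry.bdryAEEq_of_bdrySum (hf : A.MemLpBdry p (f - g)) (hp : 0 < p)
    (h : A.bdrySum p (f - g) = 0) : A.BdryAEEq f g := by
  intro r
  have h0 := (Finset.sum_eq_zero_iff_of_nonneg fun _ _ => lpNorm_nonneg).1 h r (Finset.mem_univ r)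
  have h1 := (lpNorm_eq_zero (hf r) (by simpa using hp)).1 h0
  filter_upwards [h1] with x hx
  exact sub_eq_zero.1 hx

theorem continuousOn_bdryPt (A : GraphSystem Ω) (r : Fin A.m) :
    ContinuousOn (A.bdryPt r) (openCube n A.a) := by
  have h1 : ContinuousOn (A.fn r) (openCube n A.a) :=
    (A.fn_cont r).mono fun x hx j => (hx j).le
  refine (A.coord r).continuous.comp_continuousOn ?_
  refine (PiLp.continuous_toLp 2 _).comp_continuousOn (continuousOn_pi.2 fun j => ?_)
  refine Fin.lastCases ?_ (fun i => ?_) j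
  · simpa using h1
  · simp only [Fin.snoc_castSucc]
    fun_prop

theorem bdryPt_mem_frontier (A : GraphSystem Ω) (r : Fin A.m) {x : Euc n}
    (hx : x ∈ openCube n A.a) : A.bdryPt r x ∈ frontier Ω := by
  obtain ⟨V, -, h, -⟩ := A.patch r
  have : A.bdryPt r x ∈ V ∩ frontier Ω := by rw [h]; exact ⟨x, hx, rfl⟩
  exact this.2

theorem isFiniteMeasure_openCube (m : ℕ) (a : ℝ) :
    IsFiniteMeasure ((volume : Measure (Euc m)).restrict (openCube m a)) := by
  refine ⟨?_⟩
  rw [Measure.restrict_apply_univ]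
  refine (Metric.isBounded_iff_subset_closedBall 0 |>.2
    ⟨√(m * a ^ 2), fun x hx => ?_⟩).measure_lt_top
  rw [mem_closedBall_zero_iff, EuclideanSpace.norm_eq]
  refine Real.sqrt_le_sqrt ?_
  have : ∀ j ∈ Finset.univ, ‖x j‖ ^ 2 ≤ a ^ 2 := fun j _ => by
    have := hx j
    exact pow_le_pow_left₀ (norm_nonneg _) this.le 2
  simpa using Finset.sum_le_card_nsmul _ _ _ this

theorem memLpBdry_of_continuous (hb : Bornology.IsBounded Ω) (hf : Continuous f) :
    A.MemLpBdry p f := by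
  intro r
  have hc : IsCompact (frontier Ω) :=
    hb.isCompact_closure.of_isClosed_subset isClosed_frontier frontier_subset_closure
  obtain ⟨C, hC⟩ := hc.exists_bound_of_continuousOn hf.continuousOn
  have := isFiniteMeasure_openCube n A.a
  refine MemLp.of_bound ((hf.comp_continuousOn (A.continuousOn_bdryPt r)).aestronglyMeasurable
    (measurableSet_openCube _ _)) C ?_
  filter_upwards [ae_restrict_mem (measurableSet_openCube _ _)] with x hx
  exact hC _ (A.bdryPt_mem_frontier r hx)

/-- `g` is the trace of `u`, as a limit of restrictions of smooth functions. -/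
def IsTraceOf (A : GraphSystem Ω) (p : ℝ) (u g : Euc (n + 1) → ℂ) : Prop :=
  A.MemLpBdry p g ∧ ∀ ε > 0, ∃ w : Euc (n + 1) → ℂ, ContDiff ℝ ∞ w ∧
    sobolevSum p Ω (u - w) ≤ ε ∧ A.bdrySum p (g - w) ≤ ε

theorem IsTraceOf.add (hΩ : IsOpen Ω) (hb : Bornology.IsBounded Ω) (hp : 1 ≤ p)
    (hu : MemSobolev 1 p Ω u) (hv : MemSobolev 1 p Ω v) (hf : A.IsTraceOf p u f)
    (hg : A.IsTraceOf p v g) : A.IsTraceOf p (u + v) (f + g) := by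
  refine ⟨hf.1.add hg.1, fun ε hε => ?_⟩
  obtain ⟨w, hw, h1, h2⟩ := hf.2 (ε / 2) (by positivity)
  obtain ⟨z, hz, h3, h4⟩ := hg.2 (ε / 2) (by positivity)
  refine ⟨w + z, hw.add hz, ?_, ?_⟩
  · rw [add_sub_add_comm]
    have := sobolevSum_add_le hΩ hp (hu.sub (hw.memSobolev_one hb))
      (hv.sub (hz.memSobolev_one hb))
    linarith
  · rw [add_sub_add_comm]
    have := (hf.1.sub (memLpBdry_of_continuous hb hw.continuous)).bdrySum_add_le
      (g := g - z) hp
    linarith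

theorem IsTraceOf.const_smul (hΩ : IsOpen Ω) (hb : Bornology.IsBounded Ω)
    (hu : MemSobolev 1 p Ω u) (hf : A.IsTraceOf p u f) (c : ℂ) :
    A.IsTraceOf p (c • u) (c • f) := by
  refine ⟨hf.1.const_smul c, fun ε hε => ?_⟩
  obtain ⟨w, hw, h1, h2⟩ := hf.2 (ε / (‖c‖ + 1)) (by positivity)
  have h0 : ‖c‖ * (ε / (‖c‖ + 1)) ≤ ε := by
    rw [mul_div_assoc', div_le_iff₀ (by positivity)]
    nlinarith [norm_nonneg c]
  refine ⟨c • w, hw.const_smul c, ?_, ?_⟩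
  · rw [← smul_sub, sobolevSum_const_smul hΩ (hu.sub (hw.memSobolev_one hb))]
    exact (mul_le_mul_of_nonneg_left h1 (norm_nonneg c)).trans h0
  · rw [← smul_sub, bdrySum_const_smul]
    exact (mul_le_mul_of_nonneg_left h2 (norm_nonneg c)).trans h0

theorem sobolevSum_zero (hΩ : IsOpen Ω) (hb : Bornology.IsBounded Ω) :
    sobolevSum p Ω (0 : Euc (n + 1) → ℂ) = 0 := by
  have h : ContDiff ℝ ∞ (0 : Euc (n + 1) → ℂ) := contDiff_const
  simpa using sobolevSum_const_smul hΩ (h.memSobolev_one (p := p) hb) 0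

theorem bdrySum_zero : A.bdrySum p 0 = 0 := by
  simpa using bdrySum_const_smul (A := A) (p := p) (f := 0) 0

theorem isTraceOf_self (hΩ : IsOpen Ω) (hb : Bornology.IsBounded Ω) {w : Euc (n + 1) → ℂ}
    (hw : ContDiff ℝ ∞ w) : A.IsTraceOf p w w :=
  ⟨memLpBdry_of_continuous hb hw.continuous, fun ε hε => ⟨w, hw, by
    rw [sub_self, sobolevSum_zero hΩ hb]; exact hε.le, by rw [sub_self, bdrySum_zero]; exact hε.le⟩⟩

/-- The multiplicative trace inequality for smooth functions, in terms of `bdrySum`. -/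
theorem exists_bdrySum_le_of_contDiff (A : GraphSystem Ω) (hΩ : IsOpen Ω)
    (hb : Bornology.IsBounded Ω) (hp : 1 ≤ p) :
    ∃ K : ℝ, 0 < K ∧ ∀ w : Euc (n + 1) → ℂ, ContDiff ℝ ∞ w → ∀ X Y : ℝ, 0 < X → X ≤ Y →
      lpNorm w (ENNReal.ofReal p) (volume.restrict Ω) ≤ X → sobolevSum p Ω w ≤ Y →
      A.bdrySum p w ≤ K * X ^ ((p - 1) / p) * Y ^ (1 / p) := by
  obtain ⟨K, hK, h⟩ := A.exists_eLpNorm_bdryPt_le hΩ hp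
  -- The same bound is summed over `A.m` charts; the `+ 1` gives a positive constant even without
  -- charts.
  refine ⟨(A.m + 1) * K, by positivity, fun w hw X Y hX hXY hwX hwY => ?_⟩
  have hY : 0 < Y := hX.trans_le hXY
  have hwS : MemSobolev 1 p Ω w := hw.memSobolev_one hb
  have h1 : eLpNorm w (ENNReal.ofReal p) (volume.restrict Ω) ≤ ENNReal.ofReal X := by
    rw [← ofReal_lpNorm hwS.1]
    exact ENNReal.ofReal_le_ofReal hwX
  have h2 : ∑ j, eLpNorm (fun x => fderiv ℝ w x (EuclideanSpace.single j 1)) (ENNReal.ofReal p)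
      (volume.restrict Ω) ≤ ENNReal.ofReal Y := by
    have e : ∀ j, eLpNorm (fun x => fderiv ℝ w x (EuclideanSpace.single j 1)) (ENNReal.ofReal p)
        (volume.restrict Ω) = ENNReal.ofReal (lpNorm (weakD Ω (Pi.single j 1) w)
          (ENNReal.ofReal p) (volume.restrict Ω)) := fun j => by
      rw [ofReal_lpNorm (hwS.memLp_weakD hΩ (by simp))]
      exact (eLpNorm_congr_ae ((hw.hasWeakD_single j).weakD_ae_eq hΩ)).symm
    simp_rw [e]
    rw [← ENNReal.ofReal_sum_of_nonneg fun _ _ => lpNorm_nonneg]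
    refine ENNReal.ofReal_le_ofReal (le_trans ?_ hwY)
    exact le_add_of_nonneg_left lpNorm_nonneg
  have h3 : ∀ r ∈ Finset.univ, lpNorm (fun x => w (A.bdryPt r x)) (ENNReal.ofReal p)
      (volume.restrict (openCube n A.a)) ≤ K * X ^ ((p - 1) / p) * Y ^ (1 / p) := fun r _ => by
    rw [← toReal_eLpNorm (memLpBdry_of_continuous (A := A) (p := p) hb hw.continuous
      r).aestronglyMeasurable]
    exact ENNReal.toReal_le_of_le_ofReal (by positivity) (h w hw r X Y hX hXY h1 h2)
  have h4 := Finset.sum_le_card_nsmul _ _ _ h3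
  simp only [Finset.card_univ, Fintype.card_fin, nsmul_eq_mul] at h4
  refine h4.trans ?_
  have : 0 ≤ K * X ^ ((p - 1) / p) * Y ^ (1 / p) := by positivity
  nlinarith

/-- The multiplicative trace inequality. -/
theorem exists_bdrySum_le (A : GraphSystem Ω) (hΩ : IsOpen Ω)
    (hb : Bornology.IsBounded Ω) (hp : 1 ≤ p) :
    ∃ K : ℝ, 0 < K ∧ ∀ u g, MemSobolev 1 p Ω u → A.IsTraceOf p u g →
      A.bdrySum p g ≤ K * lpNorm u (ENNReal.ofReal p) (volume.restrict Ω) ^ ((p - 1) / p) *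
        sobolevSum p Ω u ^ (1 / p) := by
  have hp0 : 0 < p := by linarith
  obtain ⟨K, hK, h⟩ := A.exists_bdrySum_le_of_contDiff hΩ hb hp
  refine ⟨K, hK, fun u g hu hg => ?_⟩
  set a := lpNorm u (ENNReal.ofReal p) (volume.restrict Ω) with ha
  set b := sobolevSum p Ω u with hb'
  have ha0 : 0 ≤ a := lpNorm_nonneg
  have hab : a ≤ b := lpNorm_le_sobolevSum
  -- Approximating by a smooth function within `ε` also makes the bound `a + ε` strictly positive,
  -- as the smooth inequality requires. Letting `ε` tend to zero is allowed since both exponents are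
  -- nonnegative, including the exponent `0` when `p = 1`.
  have hε : ∀ ε > 0, A.bdrySum p g ≤
      K * (a + ε) ^ ((p - 1) / p) * (b + ε) ^ (1 / p) + ε := by
    intro ε hε
    obtain ⟨w, hw, h1, h2⟩ := hg.2 ε hε
    have hwS : MemSobolev 1 p Ω w := hw.memSobolev_one hb
    have h3 : lpNorm w (ENNReal.ofReal p) (volume.restrict Ω) ≤ a + ε := by
      have e1 := lpNorm_le_lpNorm_add_lpNorm_sub (f := w) hu.1 (ENNReal.one_le_ofReal.2 hp)
      have e2 : lpNorm (u - w) (ENNReal.ofReal p) (volume.restrict Ω) ≤ _ :=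
        lpNorm_le_sobolevSum
      linarith
    have h4 : sobolevSum p Ω w ≤ b + ε := by
      have e1 := sobolevSum_add_le hΩ hp hu (hwS.sub hu)
      rw [sobolevSum_sub_comm hΩ hwS hu, add_sub_cancel] at e1
      linarith
    have h5 := h w hw (a + ε) (b + ε) (by positivity) (by linarith) h3 h4
    have h6 := (hg.1.sub (memLpBdry_of_continuous hb hw.continuous)).bdrySum_add_le (g := w) hp
    rw [sub_add_cancel] at h6
    linarith
  have hcont : ContinuousAt (fun ε : ℝ =>
      K * (a + ε) ^ ((p - 1) / p) * (b + ε) ^ (1 / p) + ε) 0 := by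
    have e1 : Continuous fun ε : ℝ => (a + ε) ^ ((p - 1) / p) :=
      (Real.continuous_rpow_const (div_nonneg (by linarith) hp0.le)).comp (by fun_prop)
    have e2 : Continuous fun ε : ℝ => (b + ε) ^ (1 / p) :=
      (Real.continuous_rpow_const (by positivity)).comp (by fun_prop)
    exact (((continuous_const.mul e1).mul e2).add continuous_id).continuousAt
  have hlim := hcont.tendsto.mono_left (nhdsWithin_le_nhds (s := Ioi 0))
  simp only [add_zero] at hlim
  exact ge_of_tendsto hlim (by filter_upwards [self_mem_nhdsWithin] with ε hε' using hε ε hε')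

/-- The two exponents add up to one, so bounding the `L^p` norm by `sobolevSum` gives ordinary
boundedness of the trace. -/
theorem exists_bdrySum_le_sobolevSum (A : GraphSystem Ω) (hΩ : IsOpen Ω)
    (hb : Bornology.IsBounded Ω) (hp : 1 ≤ p) :
    ∃ K : ℝ, 0 < K ∧ ∀ u g, MemSobolev 1 p Ω u → A.IsTraceOf p u g →
      A.bdrySum p g ≤ K * sobolevSum p Ω u := by
  have hp0 : 0 < p := by linarith
  obtain ⟨K, hK, h⟩ := A.exists_bdrySum_le hΩ hb hp
  refine ⟨K, hK, fun u g hu hg => (h u g hu hg).trans ?_⟩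
  have hS : 0 ≤ sobolevSum p Ω u := sobolevSum_nonneg
  have h1 : lpNorm u (ENNReal.ofReal p) (volume.restrict Ω) ^ ((p - 1) / p) ≤
      sobolevSum p Ω u ^ ((p - 1) / p) :=
    Real.rpow_le_rpow lpNorm_nonneg lpNorm_le_sobolevSum (div_nonneg (by linarith) hp0.le)
  have h2 : sobolevSum p Ω u ^ ((p - 1) / p) * sobolevSum p Ω u ^ (1 / p) =
      sobolevSum p Ω u := by
    have e : (p - 1) / p + 1 / p = 1 := by field_simp; ring
    rw [← Real.rpow_add_of_nonneg hS (div_nonneg (by linarith) hp0.le) (by positivity), e,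
      Real.rpow_one]
  rw [mul_assoc]
  refine mul_le_mul_of_nonneg_left ?_ hK.le
  calc _ ≤ sobolevSum p Ω u ^ ((p - 1) / p) * sobolevSum p Ω u ^ (1 / p) := by gcongr
    _ = _ := h2

/-- The difference of two traces of `u` is a trace of `0`, hence has norm zero. -/
theorem IsTraceOf.bdryAEEq (hΩ : IsOpen Ω) (hb : Bornology.IsBounded Ω) (hp : 1 ≤ p)
    (hu : MemSobolev 1 p Ω u) (hf : A.IsTraceOf p u f) (hg : A.IsTraceOf p u g) :
    A.BdryAEEq f g := by
  obtain ⟨K, hK, h⟩ := A.exists_bdrySum_le_sobolevSum hΩ hb hp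
  have h1 := hf.add hΩ hb hp hu (hu.const_smul (-1)) (hg.const_smul hΩ hb hu (-1))
  have h2 := h _ _ (hu.add (hu.const_smul (-1))) h1
  simp only [neg_smul, one_smul, ← sub_eq_add_neg, sub_self, sobolevSum_zero hΩ hb,
    mul_zero] at h2
  exact (hf.1.sub hg.1).bdryAEEq_of_bdrySum (by linarith) (le_antisymm h2 bdrySum_nonneg)

/-- Completeness of `L^p(∂Ω)`: a sequence of continuous functions with summable boundary
distances converges. -/
theorem exists_bdry_limit (A : GraphSystem Ω) (hb : Bornology.IsBounded Ω) (hp : 1 ≤ p)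
    {w : ℕ → Euc (n + 1) → ℂ} (hw : ∀ k, Continuous (w k)) {c : ℕ → ℝ}
    (hc : Tendsto c atTop (𝓝 0))
    (hcw : ∀ k l, A.bdrySum p (w k - w l) ≤ c k + c l) :
    ∃ g, A.MemLpBdry p g ∧ Tendsto (fun k => A.bdrySum p (g - w k)) atTop (𝓝 0) := by
  have hp0 : 0 < p := by linarith
  have : Fact (1 ≤ ENNReal.ofReal p) := ⟨ENNReal.one_le_ofReal.2 hp⟩
  set m := (volume : Measure (Euc n)).restrict (openCube n A.a) with hm
  have hbm : ∀ r, AEMeasurable (A.bdryPt r) m := fun r =>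
    (A.continuousOn_bdryPt r).aemeasurable (measurableSet_openCube _ _)
  -- The charts may overlap, and separate limits in each chart would still have to be glued. Adding
  -- the images of Lebesgue measure under all charts gives one measure whose `L^p` norm is
  -- equivalent to the boundary norm, so the limit is a single function of the boundary point.
  set σ : Measure (Euc (n + 1)) := ∑ r, m.map (A.bdryPt r) with hσ
  have hle : ∀ r, m.map (A.bdryPt r) ≤ σ := fun r =>
    Finset.single_le_sum (f := fun r => m.map (A.bdryPt r)) (fun _ _ => Measure.zero_le _)
      (Finset.mem_univ r)
  have hmem : ∀ f : Euc (n + 1) → ℂ, MemLp f (ENNReal.ofReal p) σ → A.MemLpBdry p f :=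
    fun f hf r => (memLp_map_measure_iff (hf.mono_measure (hle r)).aestronglyMeasurable
      (hbm r)).1 (hf.mono_measure (hle r))
  have hsum : ∀ f : Euc (n + 1) → ℂ, MemLp f (ENNReal.ofReal p) σ →
      A.bdrySum p f ≤ A.m * (eLpNorm f (ENNReal.ofReal p) σ).toReal := by
    intro f hf
    have h1 : ∀ r ∈ Finset.univ, lpNorm (fun x => f (A.bdryPt r x)) (ENNReal.ofReal p) m ≤
        (eLpNorm f (ENNReal.ofReal p) σ).toReal := fun r _ => by
      rw [← toReal_eLpNorm (hmem f hf r).aestronglyMeasurable]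
      refine ENNReal.toReal_mono hf.2.ne ?_
      refine le_trans (le_of_eq ?_) (eLpNorm_mono_measure f (hle r))
      exact (eLpNorm_map_measure (hf.mono_measure (hle r)).aestronglyMeasurable (hbm r)).symm
    simpa [bdrySum] using Finset.sum_le_card_nsmul _ _ _ h1
  have hcont : ∀ f : Euc (n + 1) → ℂ, Continuous f →
      eLpNorm f (ENNReal.ofReal p) σ ≤ ENNReal.ofReal ((A.m : ℝ) ^ (1 / p) * A.bdrySum p f) := by
    intro f hf
    have hfb : A.MemLpBdry p f := memLpBdry_of_continuous hb hf
    have hS : 0 ≤ A.bdrySum p f := bdrySum_nonneg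
    rw [← ENNReal.rpow_le_rpow_iff hp0, eLpNorm_ofReal_rpow _ hp0, hσ,
      lintegral_finsetSum_measure, ENNReal.ofReal_rpow_of_nonneg (by positivity) hp0.le,
      Real.mul_rpow (by positivity) hS, one_div, Real.rpow_inv_rpow (by positivity) hp0.ne']
    have h1 : ∀ r ∈ Finset.univ, ∫⁻ z, ‖f z‖ₑ ^ p ∂(m.map (A.bdryPt r)) ≤
        ENNReal.ofReal (A.bdrySum p f ^ p) := fun r hr => by
      have e : eLpNorm (f ∘ A.bdryPt r) (ENNReal.ofReal p) m = ENNReal.ofReal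
          (lpNorm (fun x => f (A.bdryPt r x)) (ENNReal.ofReal p) m) := (ofReal_lpNorm (hfb r)).symm
      rw [← eLpNorm_ofReal_rpow _ hp0, eLpNorm_map_measure hf.aestronglyMeasurable (hbm r), e,
        ENNReal.ofReal_rpow_of_nonneg lpNorm_nonneg hp0.le]
      refine ENNReal.ofReal_le_ofReal (Real.rpow_le_rpow lpNorm_nonneg ?_ hp0.le)
      exact Finset.single_le_sum (f := fun r =>
        lpNorm (fun x => f (A.bdryPt r x)) (ENNReal.ofReal p) m) (fun _ _ => lpNorm_nonneg) hr
    refine (Finset.sum_le_card_nsmul _ _ _ h1).trans (le_of_eq ?_)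
    rw [← ENNReal.ofReal_nsmul]
    simp
  have hwm : ∀ k, MemLp (w k) (ENNReal.ofReal p) σ := fun k =>
    ⟨(hw k).aestronglyMeasurable, (hcont _ (hw k)).trans_lt ENNReal.ofReal_lt_top⟩
  have hcau : CauchySeq fun k => (hwm k).toLp (w k) := by
    rw [Metric.cauchySeq_iff]
    intro ε hε
    have hlim : Tendsto (fun k => (A.m : ℝ) ^ (1 / p) * c k) atTop (𝓝 0) := by
      simpa using hc.const_mul ((A.m : ℝ) ^ (1 / p))
    obtain ⟨N, hN⟩ := eventually_atTop.1 (hlim.eventually_lt_const (half_pos hε))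
    refine ⟨N, fun k hk l hl => ?_⟩
    rw [Lp.dist_def, eLpNorm_congr_ae ((hwm k).coeFn_toLp.sub (hwm l).coeFn_toLp)]
    have h1 := ENNReal.toReal_le_of_le_ofReal
      (mul_nonneg (by positivity) bdrySum_nonneg) (hcont _ ((hw k).sub (hw l)))
    have h2 : (A.m : ℝ) ^ (1 / p) * A.bdrySum p (w k - w l) ≤
        (A.m : ℝ) ^ (1 / p) * (c k + c l) := by
      gcongr
      exact hcw k l
    have h3 := hN k hk
    have h4 := hN l hl
    rw [mul_add] at h2
    exact (h1.trans h2).trans_lt (by linarith)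
  obtain ⟨G, hG⟩ := cauchySeq_tendsto_of_complete hcau
  refine ⟨G, hmem _ (Lp.memLp G), ?_⟩
  have h1 : Tendsto (fun k => A.m * dist ((hwm k).toLp (w k)) G) atTop (𝓝 0) := by
    simpa using (tendsto_iff_dist_tendsto_zero.1 hG).const_mul (A.m : ℝ)
  refine squeeze_zero (fun _ => bdrySum_nonneg) (fun k => ?_) h1
  refine (hsum _ ((Lp.memLp G).sub (hwm k))).trans (le_of_eq ?_)
  rw [dist_comm, Lp.dist_def,
    eLpNorm_congr_ae ((EventuallyEq.refl (ae σ) (G : Euc (n + 1) → ℂ)).sub (hwm k).coeFn_toLp)]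

/-- The trace bound, applied to the smooth differences `w k - w l`, makes the restrictions of an
approximating sequence Cauchy on the boundary. -/
theorem exists_isTraceOf (hΩ : IsOpen Ω) (hb : Bornology.IsBounded Ω) (hp : 1 ≤ p)
    (hu : MemSobolev 1 p Ω u) : ∃ g, A.IsTraceOf p u g := by
  obtain ⟨K, hK, hKb⟩ := A.exists_bdrySum_le_sobolevSum hΩ hb hp
  have hpos : ∀ k : ℕ, (0 : ℝ) < 1 / (k + 1) := fun k => by positivity
  choose w hw hwu using fun k : ℕ =>
    hu.exists_sobolevSum_sub_le hΩ hb (A.hasInwardShifts hΩ) hp (hpos k)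
  have hwS : ∀ k, MemSobolev 1 p Ω (w k) := fun k => (hw k).memSobolev_one hb
  have hcau : ∀ k l, A.bdrySum p (w k - w l) ≤ K * (1 / (k + 1)) + K * (1 / (l + 1)) := by
    intro k l
    refine (hKb _ _ ((hwS k).sub (hwS l)) (isTraceOf_self hΩ hb ((hw k).sub (hw l)))).trans ?_
    rw [← mul_add]
    refine mul_le_mul_of_nonneg_left ?_ hK.le
    have := sobolevSum_add_le hΩ hp ((hwS k).sub hu) (hu.sub (hwS l))
    rw [sub_add_sub_cancel, sobolevSum_sub_comm hΩ (hwS k) hu] at this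
    exact this.trans (add_le_add (hwu k) (hwu l))
  have hlim : Tendsto (fun k : ℕ => K * (1 / ((k : ℝ) + 1))) atTop (𝓝 0) := by
    simpa using (tendsto_one_div_add_atTop_nhds_zero_nat (𝕜 := ℝ)).const_mul K
  obtain ⟨g, hg, hgw⟩ := A.exists_bdry_limit hb hp (fun k => (hw k).continuous) hlim hcau
  refine ⟨g, hg, fun ε hε => ?_⟩
  obtain ⟨k, hk1, hk2⟩ := ((hgw.eventually_le_const hε).and
    ((tendsto_one_div_add_atTop_nhds_zero_nat (𝕜 := ℝ)).eventually_le_const hε)).exists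
  exact ⟨w k, hw k, (hwu k).trans hk2, hk1⟩

/-- A trace map exists. -/
theorem exists_isTraceMap (A : GraphSystem Ω) (hΩ : IsOpen Ω) (hb : Bornology.IsBounded Ω)
    (hp : 1 ≤ p) : ∃ γ, A.IsTraceMap p γ := by
  classical
  have hp0 : 0 < p := by linarith
  obtain ⟨K, hK, hKb⟩ := A.exists_bdrySum_le_sobolevSum hΩ hb hp
  -- The values are picked by choice; linearity holds almost everywhere because traces are unique
  -- and stable under sums and multiples.
  let γ : (Euc (n + 1) → ℂ) → (Euc (n + 1) → ℂ) := fun u =>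
    if h : ∃ g, A.IsTraceOf p u g then h.choose else 0
  have hγ : ∀ u, MemSobolev 1 p Ω u → A.IsTraceOf p u (γ u) := fun u hu => by
    have h : ∃ g, A.IsTraceOf p u g := exists_isTraceOf hΩ hb hp hu
    simp only [γ, dif_pos h]
    exact h.choose_spec
  refine ⟨γ, fun u hu => (hγ u hu).1, fun u v hu hv => ?_, fun c u hu => ?_, ?_, fun u hu => ?_⟩
  · exact (hγ _ (hu.add hv)).bdryAEEq hΩ hb hp (hu.add hv)
      ((hγ u hu).add hΩ hb hp hu hv (hγ v hv))
  · exact (hγ _ (hu.const_smul c)).bdryAEEq hΩ hb hp (hu.const_smul c)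
      ((hγ u hu).const_smul hΩ hb hu c)
  · refine ⟨(A.m : ℝ) ^ (1 / p) * (K * (1 + (n + 1 : ℕ))), fun u hu => ?_⟩
    refine ((hγ u hu).1.bdryNorm_le hp0).trans ?_
    rw [mul_assoc]
    refine mul_le_mul_of_nonneg_left ((hKb u _ hu (hγ u hu)).trans ?_) (by positivity)
    rw [mul_assoc]
    exact mul_le_mul_of_nonneg_left (hu.sobolevSum_le hΩ hp0) hK.le
  · have huS : MemSobolev 1 p Ω u := hu.memSobolev_one hb
    exact (hγ u huS).bdryAEEq hΩ hb hp huS (isTraceOf_self hΩ hb hu)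

/-- Every trace map gives traces in the sense of limits of smooth functions. -/
theorem IsTraceMap.isTraceOf {γ : (Euc (n + 1) → ℂ) → (Euc (n + 1) → ℂ)}
    (hγ : A.IsTraceMap p γ) (hΩ : IsOpen Ω) (hb : Bornology.IsBounded Ω) (hp : 1 ≤ p)
    (hu : MemSobolev 1 p Ω u) : A.IsTraceOf p u (γ u) := by
  have hp0 : 0 < p := by linarith
  obtain ⟨C, hC⟩ := hγ.bounded
  obtain ⟨C', hC'0, hC'⟩ := exists_sobolevNorm_le_sobolevSum hΩ hp0
  refine ⟨hγ.mem u hu, fun ε hε => ?_⟩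
  set D := A.m * (|C| * C') with hD
  have hD0 : 0 ≤ D := by positivity
  obtain ⟨w, hw, hwu⟩ := hu.exists_sobolevSum_sub_le hΩ hb (A.hasInwardShifts hΩ) hp
    (ε := ε / (D + 1)) (by positivity)
  refine ⟨w, hw, hwu.trans (div_le_self hε.le (by linarith)), ?_⟩
  have hwS : MemSobolev 1 p Ω w := hw.memSobolev_one hb
  have huw := hu.sub hwS
  -- Since `γ` fixes smooth functions, the boundary error is itself a trace, and boundedness of `γ`
  -- controls it by the error in `Ω`.
  have e : A.BdryAEEq (γ u - w) (γ (u - w)) := by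
    intro r
    have h1 := hγ.map_add u ((-1 : ℂ) • w) hu (hwS.const_smul _) r
    have h2 := hγ.map_smul (-1) w hwS r
    have h3 := hγ.smooth w hw r
    filter_upwards [h1, h2, h3] with x h1 h2 h3
    rw [show u - w = u + (-1 : ℂ) • w by simp [sub_eq_add_neg], h1, Pi.add_apply, h2,
      Pi.smul_apply, h3]
    simp [sub_eq_add_neg]
  rw [bdrySum_congr e]
  calc A.bdrySum p (γ (u - w)) ≤ A.m * A.bdryNorm p (γ (u - w)) :=
        (hγ.mem _ huw).bdrySum_le hp0
    _ ≤ A.m * (|C| * (C' * sobolevSum p Ω (u - w))) := by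
        refine mul_le_mul_of_nonneg_left ((hC _ huw).trans ?_) (by positivity)
        exact mul_le_mul (le_abs_self C) (hC' _ huw) sobolevNorm_nonneg (abs_nonneg C)
    _ = D * sobolevSum p Ω (u - w) := by rw [hD]; ring
    _ ≤ D * (ε / (D + 1)) := by gcongr
    _ ≤ ε := by
        rw [mul_div_assoc', div_le_iff₀ (by positivity)]
        nlinarith

end GraphSystem

/-! ## The normal derivative -/

namespace GraphSystem

variable {n : ℕ} {Ω : Set (Euc (n + 1))} {A : GraphSystem Ω} {p : ℝ}

/-- `outerNormal` picks a chart by choice, so measurability is read off the local formula instead.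
The derivative of any function here is measurable, so no regularity of `A.fn r` is needed. -/
theorem measurable_localNormal_apply (A : GraphSystem Ω) (r : Fin A.m) (j : Fin (n + 1)) :
    Measurable fun x => A.localNormal r x j := by
  have h1 : Measurable fun x => gradient (A.fn r) x :=
    (LinearIsometryEquiv.continuous _).measurable.comp (measurable_fderiv ℝ (A.fn r))
  have h2 : Continuous fun y : Euc n => joinLast y (-1) := by
    refine (PiLp.continuous_toLp 2 _).comp (continuous_pi fun j => ?_)
    refine Fin.lastCases ?_ (fun i => ?_) j
    · simp only [Fin.snoc_last]
      fun_prop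
    · simp only [Fin.snoc_castSucc]
      fun_prop
  have h3 : Measurable fun x => A.localNormal r x := by
    refine (LinearIsometryEquiv.continuous _).measurable.comp ?_
    exact (by fun_prop : Measurable fun x => (√(1 + ‖gradient (A.fn r) x‖ ^ 2))⁻¹).smul
      (h2.measurable.comp h1)
  exact (by fun_prop : Continuous fun z : Euc (n + 1) => z j).measurable.comp h3

/-- The product of a function with a component of the outer normal. -/
theorem MemLpBdry.outerNormal_mul {k : ℕ} {μ : ℝ≥0} (hA : A.IsOfClass k μ) (hk : 1 ≤ k)
    {f : Euc (n + 1) → ℂ} (hf : A.MemLpBdry p f) (j : Fin (n + 1)) :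
    A.MemLpBdry p (fun z => (A.outerNormal z j : ℂ) * f z) ∧
      A.bdrySum p (fun z => (A.outerNormal z j : ℂ) * f z) ≤ A.bdrySum p f := by
  have hae : ∀ r, (fun x => (A.localNormal r x j : ℂ) * f (A.bdryPt r x))
      =ᵐ[volume.restrict (openCube n A.a)]
        fun x => (A.outerNormal (A.bdryPt r x) j : ℂ) * f (A.bdryPt r x) := fun r => by
    filter_upwards [ae_restrict_mem (measurableSet_openCube _ _)] with x hx
    rw [outerNormal_bdryPt hA hk r hx]
  have hle : ∀ r x, ‖(A.localNormal r x j : ℂ) * f (A.bdryPt r x)‖ ≤ ‖f (A.bdryPt r x)‖ :=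
    fun r x => by
      rw [norm_mul, Complex.norm_real]
      refine mul_le_of_le_one_left (norm_nonneg _) ?_
      rw [← A.norm_localNormal r x]
      exact PiLp.norm_apply_le _ j
  have hmem : ∀ r, MemLp (fun x => (A.localNormal r x j : ℂ) * f (A.bdryPt r x))
      (ENNReal.ofReal p) (volume.restrict (openCube n A.a)) := fun r =>
    (hf r).of_le ((Complex.measurable_ofReal.comp
      (A.measurable_localNormal_apply r j)).aestronglyMeasurable.mul
        (hf r).aestronglyMeasurable) (ae_of_all _ (hle r))
  refine ⟨fun r => (hmem r).ae_eq (hae r), Finset.sum_le_sum fun r _ => ?_⟩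
  rw [← lpNorm_congr_ae (hae r), ← lpNorm_norm (hf r).aestronglyMeasurable]
  exact lpNorm_mono_real (hf r).norm (hle r)

theorem bdrySum_sum_le (hp : 1 ≤ p) {ι : Type*} (s : Finset ι) {F : ι → Euc (n + 1) → ℂ}
    (hF : ∀ i ∈ s, A.MemLpBdry p (F i)) :
    A.MemLpBdry p (∑ i ∈ s, F i) ∧ A.bdrySum p (∑ i ∈ s, F i) ≤ ∑ i ∈ s, A.bdrySum p (F i) := by
  classical
  induction s using Finset.induction_on with
  | empty =>
    simp only [Finset.sum_empty, bdrySum_zero]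
    exact ⟨fun r => MemLp.zero, le_rfl⟩
  | insert i s hi ih =>
    obtain ⟨h1, h2⟩ := ih fun k hk => hF k (Finset.mem_insert_of_mem hk)
    have h3 := hF i (Finset.mem_insert_self i s)
    rw [Finset.sum_insert hi, Finset.sum_insert hi]
    exact ⟨h3.add h1, (h3.bdrySum_add_le hp).trans (by linarith)⟩

/-- The multiplicative trace inequality for every trace map. -/
theorem exists_bdrySum_trace_le (A : GraphSystem Ω) (hΩ : IsOpen Ω)
    (hb : Bornology.IsBounded Ω) (hp : 1 ≤ p) :
    ∃ K : ℝ, 0 < K ∧ ∀ γ, A.IsTraceMap p γ → ∀ u, MemSobolev 1 p Ω u →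
      A.bdrySum p (γ u) ≤ K * lpNorm u (ENNReal.ofReal p) (volume.restrict Ω) ^ ((p - 1) / p) *
        sobolevNorm 1 p Ω u ^ (1 / p) := by
  have hp0 : 0 < p := by linarith
  obtain ⟨K, hK, h⟩ := A.exists_bdrySum_le hΩ hb hp
  refine ⟨K * (1 + (n + 1 : ℕ) : ℝ) ^ (1 / p), by positivity, fun γ hγ u hu => ?_⟩
  have h0 : 0 ≤ lpNorm u (ENNReal.ofReal p) (volume.restrict Ω) ^ ((p - 1) / p) :=
    Real.rpow_nonneg lpNorm_nonneg _
  have h1 : sobolevSum p Ω u ^ (1 / p) ≤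
      (1 + (n + 1 : ℕ) : ℝ) ^ (1 / p) * sobolevNorm 1 p Ω u ^ (1 / p) := by
    rw [← Real.mul_rpow (by positivity) sobolevNorm_nonneg]
    exact Real.rpow_le_rpow sobolevSum_nonneg (hu.sobolevSum_le hΩ hp0) (by positivity)
  refine (h u _ hu (hγ.isTraceOf hΩ hb hp hu)).trans
    ((mul_le_mul_of_nonneg_left h1 (by positivity)).trans (le_of_eq (by ring)))

end GraphSystem

theorem proposition7p4 {n : ℕ} (Ω : Set (Euc (n + 1))) (hΩ_open : IsOpen Ω)
    (hΩ_conn : IsConnected Ω) (hΩ_bdd : Bornology.IsBounded Ω)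
    (A : GraphSystem Ω) (hA : A.IsOfClass 2 1) (p : ℝ) (hp : 1 ≤ p) :
    (∃ γ, A.IsTraceMap p γ) ∧
    ∃ c : ℝ, 0 < c ∧ ∀ γ, A.IsTraceMap p γ → ∀ u, MemSobolev 2 p Ω u →
      A.MemLpBdry p (A.normalD γ u) ∧
      A.bdryNorm p (A.normalD γ u) ≤
        c * sobolevNorm 1 p Ω u ^ ((p - 1) / p) * sobolevNorm 2 p Ω u ^ (1 / p) := by
  refine ⟨A.exists_isTraceMap hΩ_open hΩ_bdd hp, ?_⟩
  have hp0 : 0 < p := by linarith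
  obtain ⟨K, hK, hKb⟩ := A.exists_bdrySum_trace_le hΩ_open hΩ_bdd hp
  obtain ⟨C, hC, hCb⟩ := exists_sobolevNorm_weakD_le (p := p) hΩ_open hp0
  -- The factors come from comparing `bdryNorm` with `bdrySum`, from the `n + 1` components of the
  -- normal, from the trace inequality, and from the norm of `∂_j u` in `W^{1,p}`. The final
  -- constant is `M + 1`, which is positive even if `M = 0`.
  set M : ℝ := (A.m : ℝ) ^ (1 / p) * ((n + 1 : ℕ) * (K * C ^ (1 / p))) with hM
  have hM0 : 0 ≤ M := by positivity
  refine ⟨M + 1, by positivity, fun γ hγ u hu => ?_⟩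
  set X := sobolevNorm 1 p Ω u with hX
  set Y := sobolevNorm 2 p Ω u with hY
  have hX0 : 0 ≤ X := sobolevNorm_nonneg
  have hY0 : 0 ≤ Y := sobolevNorm_nonneg
  have hu1 : MemSobolev 1 p Ω u := hu.mono one_le_two
  have hD : ∀ j, MemSobolev 1 p Ω (weakD Ω (Pi.single j 1) u) := fun j =>
    hu.weakD_single hΩ_open j
  have hmul := fun j => (hγ.mem _ (hD j)).outerNormal_mul hA one_le_two j
  have hterm : ∀ j ∈ (Finset.univ : Finset (Fin (n + 1))),
      A.bdrySum p (fun z => (A.outerNormal z j : ℂ) * γ (weakD Ω (Pi.single j 1) u) z) ≤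
        K * C ^ (1 / p) * (X ^ ((p - 1) / p) * Y ^ (1 / p)) := fun j _ => by
    refine (hmul j).2.trans ((hKb γ hγ _ (hD j)).trans ?_)
    -- The `L^p` factor of the trace inequality costs one derivative of `u`, the `W^{1,p}` factor
    -- two; this yields the two norms on the right side.
    have h1 : lpNorm (weakD Ω (Pi.single j 1) u) (ENNReal.ofReal p) (volume.restrict Ω) ^
        ((p - 1) / p) ≤ X ^ ((p - 1) / p) :=
      Real.rpow_le_rpow lpNorm_nonneg (hu1.lpNorm_weakD_le hΩ_open hp0 (by simp))
        (div_nonneg (by linarith) hp0.le)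
    have h2 : sobolevNorm 1 p Ω (weakD Ω (Pi.single j 1) u) ^ (1 / p) ≤
        C ^ (1 / p) * Y ^ (1 / p) := by
      rw [← Real.mul_rpow hC hY0]
      exact Real.rpow_le_rpow sobolevNorm_nonneg (hCb u hu j) (by positivity)
    have h3 : 0 ≤ sobolevNorm 1 p Ω (weakD Ω (Pi.single j 1) u) ^ (1 / p) :=
      Real.rpow_nonneg sobolevNorm_nonneg _
    calc _ ≤ K * X ^ ((p - 1) / p) * (C ^ (1 / p) * Y ^ (1 / p)) := by gcongr
      _ = _ := by ring
  have heq : A.normalD γ u = ∑ j, fun z =>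
      (A.outerNormal z j : ℂ) * γ (weakD Ω (Pi.single j 1) u) z := by
    ext z
    simp [GraphSystem.normalD]
  obtain ⟨hmem, hle⟩ := GraphSystem.bdrySum_sum_le hp Finset.univ fun j _ => (hmul j).1
  rw [heq]
  refine ⟨hmem, (hmem.bdryNorm_le hp0).trans ?_⟩
  have hsum := hle.trans (Finset.sum_le_card_nsmul _ _ _ hterm)
  simp only [Finset.card_univ, Fintype.card_fin, nsmul_eq_mul] at hsum
  have hXY : 0 ≤ X ^ ((p - 1) / p) * Y ^ (1 / p) := by positivity
  calc _ ≤ (A.m : ℝ) ^ (1 / p) * (((n + 1 : ℕ) : ℝ) *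
        (K * C ^ (1 / p) * (X ^ ((p - 1) / p) * Y ^ (1 / p)))) := by gcongr
    _ = M * (X ^ ((p - 1) / p) * Y ^ (1 / p)) := by rw [hM]; ring
    _ ≤ (M + 1) * (X ^ ((p - 1) / p) * Y ^ (1 / p)) := by gcongr; linarith
    _ = _ := by ring
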